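/- Let $n\ge 3$ and let $\mathcal K$ be the boundary of an $n$-gon, i.e. the simplicial complex with vertex set $\mathbb Z/n$ whose faces are $\emptyset$, the vertices $\{i\}$ and the edges $\{i,i+1\}$. With $D^1=[-1,1]$ and $S^0=\{-1,1\}$, let $$\mathcal Z_{\mathcal K}(D^1,S^0)=\bigcup_{\sigma\in\mathcal K}\{x\in (D^1)^n : x_i\in S^0 \text{ for all } i\notin\sigma\}\subset\mathbb R^n$$ be the real moment-angle complex of $\mathcal K$, on which the cyclic group $C_n=\langle\sigma\rangle$ acts by rotating the coordinates, $\sigma(x_1,\dots,x_n)=(x_2,\dots,x_n,x_1)$. Then the quotient space $\mathcal Z_{\mathcal K}(D^1,S^0)/C_n$ is a closed, connected, orientable surface: it is a compact, connected, Hausdorff, second countable topological manifold of dimension $2$ without boundary, and it has an atlas of charts onto open subsets of the plane all of whose transition maps preserve the orientation of the plane (have local degree $+1$ at every point). -/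

import Mathlib

open Set Topology

noncomputable section

/-- The (polyhedral product) moment-angle complex `Z_K(X, A)` of a pair `A ⊆ X` of subspaces of a
space `Y` and a simplicial complex `K` on the vertex set `ι`: the union, over the faces `σ` of `K`
(the empty face included), of the products `∏ Y_i` with `Y_i = X` for `i ∈ σ` and `Y_i = A` for
`i ∉ σ`. It carries the topology of a subspace of the product `ι → Y`. -/
def momentAngleComplex {ι Y : Type*} (K : AbstractSimplicialComplex ι) (X A : Set Y) :
    Set (ι → Y) :=
  {x | ∃ σ : Finset ι, (σ = ∅ ∨ σ ∈ K.faces) ∧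
    (∀ i ∈ σ, x i ∈ X) ∧ (∀ i, i ∉ σ → x i ∈ A)}

/-- The boundary of an `n`-gon (`n ≥ 3`) as a simplicial complex: the vertices are the residues
modulo `n` and the edges are the pairs `{i, i + 1}`; so the faces are the nonempty subsets of
these edges. -/
def polygonBoundary (n : ℕ) : AbstractSimplicialComplex (ZMod n) where
  faces := {σ | σ.Nonempty ∧ ∃ i : ZMod n, σ ⊆ {i, i + 1}}
  isRelLowerSet_faces := by
    rintro σ ⟨hσ, i, hi⟩
    exact ⟨hσ, fun τ hτ hne => ⟨hne, i, Finset.Subset.trans hτ hi⟩⟩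
  singleton_mem v := ⟨Finset.singleton_nonempty v, v, by simp⟩

/-- The real moment-angle complex `Z_K(D¹, S⁰)` where `K` is the boundary of an `n`-gon,
`D¹ = [-1, 1]` and `S⁰ = {-1, 1}`. -/
def polygonMomentAngle (n : ℕ) : Set (ZMod n → ℝ) :=
  momentAngleComplex (polygonBoundary n) (Metric.closedBall (0 : ℝ) 1) (Metric.sphere (0 : ℝ) 1)

theorem polygonMomentAngle_rotate {n : ℕ} (g : ZMod n) {x : ZMod n → ℝ}
    (hx : x ∈ polygonMomentAngle n) : (fun i => x (i + g)) ∈ polygonMomentAngle n := by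
  classical
  obtain ⟨σ, hσ, h1, h2⟩ := hx
  refine ⟨σ.image (fun j => j - g), ?_, ?_, ?_⟩
  · rcases hσ with rfl | ⟨hne, i, hi⟩
    · left; simp
    · right
      refine ⟨hne.image _, i - g, ?_⟩
      intro j hj
      obtain ⟨k, hk, rfl⟩ := Finset.mem_image.1 hj
      have hk' := hi hk
      simp only [Finset.mem_insert, Finset.mem_singleton] at hk' ⊢
      rcases hk' with rfl | rfl
      · left; rfl
      · right; ring
  · intro i hi
    obtain ⟨k, hk, rfl⟩ := Finset.mem_image.1 hi
    simpa using h1 k hk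
  · intro i hi
    refine h2 _ fun h => hi (Finset.mem_image.2 ⟨_, h, by simp⟩)

/-- The cyclic group `C_n` (written additively, as `ZMod n`) acts on `Z_K(D¹, S⁰)` by rotating the
coordinates: the generator `1` sends `(x₁, x₂, …, xₙ)` to `(x₂, …, xₙ, x₁)`. -/
instance polygonMomentAngle.instAddAction (n : ℕ) : AddAction (ZMod n) (polygonMomentAngle n) where
  vadd g x := ⟨fun i => x.1 (i + g), polygonMomentAngle_rotate g x.2⟩
  zero_vadd x := Subtype.ext (funext fun i => congrArg x.1 (add_zero i))
  add_vadd g h x := Subtype.ext (funext fun i => congrArg x.1 (by ring))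

/-- The orbit space `Z_K(D¹, S⁰) / C_n`, with the quotient topology. -/
abbrev PolygonQuotient (n : ℕ) : Type :=
  Quotient (AddAction.orbitRel (ZMod n) (polygonMomentAngle n))

/-- The loop `γ : [0, 2π] → ℂ` avoids the origin and winds `k` times around it: it has a
continuous choice `θ` of the argument, and this increases by `2πk` in total. -/
def HasWindingNumber (γ : ℝ → ℂ) (k : ℤ) : Prop :=
  ∃ θ : ℝ → ℝ, ContinuousOn θ (Icc 0 (2 * Real.pi)) ∧
    (∀ t ∈ Icc 0 (2 * Real.pi), γ t ≠ 0 ∧ γ t = ‖γ t‖ * Complex.exp (θ t * Complex.I)) ∧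
    θ (2 * Real.pi) - θ 0 = 2 * Real.pi * k

/-- A map `f` between open parts of the plane that is a homeomorphism near `z` preserves the
orientation at `z` if it has local degree `1` there: the image of every small circle around `z`,
run through once counterclockwise, winds exactly once counterclockwise around `f z`. -/
def PreservesOrientationAt (f : ℂ → ℂ) (z : ℂ) : Prop :=
  ∀ᶠ r : ℝ in 𝓝[>] 0, HasWindingNumber (fun t => f (circleMap z r t) - f z) 1

/-- `X` is a closed surface: a compact topological manifold of dimension 2 without boundary
(Hausdorff, second countable, covered by charts onto open subsets of `ℝ²`). -/
structure IsClosedSurface (X : Type*) [TopologicalSpace X] : Prop where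
  t2 : T2Space X
  secondCountable : SecondCountableTopology X
  compact : CompactSpace X
  charts : ∀ x : X, ∃ e : OpenPartialHomeomorph X (EuclideanSpace ℝ (Fin 2)), x ∈ e.source

/-- Orientability of a topological surface: there is an atlas of charts to the plane (here `ℂ`)
all of whose transition maps preserve the orientation of the plane. -/
def IsOrientableSurface (X : Type*) [TopologicalSpace X] : Prop :=
  ∃ A : Set (OpenPartialHomeomorph X ℂ), (∀ x : X, ∃ e ∈ A, x ∈ e.source) ∧
    ∀ e ∈ A, ∀ e' ∈ A, ∀ z ∈ (e.symm.trans e').source,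
      PreservesOrientationAt (e.symm.trans e') z

end

/-!
The quotient of the real moment-angle complex of the boundary of an `n`-gon by the rotations is a
closed orientable surface because it is a Riemann surface: the squares of the complex are flat, with
cone points at the vertices, and charts can be chosen to be conformal for this flat structure.

The complex is a union of squares `[-1, 1]²`, two along every edge, and `n` of them, cyclically
arranged, around every vertex. At an edge the two squares unfold to a rectangle in the plane; this
gives the flat coordinates `edgeCoord`. The square in the directions `i`, `i + 1` is oriented by
`dxᵢ ∧ dxᵢ₊₁` times the product of the remaining coordinates, which are signs. With these
orientations any two flat coordinates differ locally by a complex affine map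
(`edgeCoord_compatible`), and the rotations permute them (`edgeCoord_vadd`).

A rotation other than the identity fixes no points but vertices (`eq_zero_of_vadd_eq_self`), so the
flat coordinates are charts of the quotient near all other points. At a vertex `ε` with stabilizer
of order `m`, the squares around it form a cone of angle `nπ/2`, and the stabilizer rotates this
cone. The `4m/n`-th powers of the flat coordinates on the half planes around the edges, each turned
by a suitable root of unity, fit together to a map on the cone. This map is continuous and open with
the orbits of the stabilizer as its fibres (`continuousOn_coneChart`, `nhds_le_map_coneChart`,
`coneChart_eq_iff`). Hence it induces a chart of the quotient at the vertex, which is conformal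
outside the vertex. The edges around `ε` run counterclockwise if the product of the signs `ε j` is
`1` and clockwise otherwise, in which case the chart is composed with complex conjugation.

Taking one such chart for each point of the quotient (`exists_flat_chart`), the image of a vertex
lies in a single chart. So a transition map is either the identity near the given point, or it has a
nonzero complex derivative there, and then it has local degree `1`
(`PreservesOrientationAt.of_hasDerivAt`).
-/

/-! ### Local degree and charts of a quotient -/

open Filter Complex in
/-- A planar map that is complex differentiable at `z` with nonzero derivative has local degree `1`
there: `f w - f z = (w - z) * g w` with `g` continuous and nonzero at `z`, so that on small circles
the argument of `f w - f z` is that of `w - z` plus a periodic function. -/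
theorem PreservesOrientationAt.of_hasDerivAt {f : ℂ → ℂ} {z c : ℂ} (hf : HasDerivAt f c z)
    (hc : c ≠ 0) (hcont : ∀ᶠ w in 𝓝 z, ContinuousAt f w) : PreservesOrientationAt f z := by
  have hg : Tendsto (fun w => (f w - f z) / (w - z) / c) (𝓝[≠] z) (𝓝 1) := by
    have h := (hasDerivAt_iff_tendsto_slope.1 hf).div_const c
    rw [div_self hc] at h
    refine h.congr fun w => ?_
    rw [slope_def_field]
  have h1 : ∀ᶠ w in 𝓝 z, w ≠ z → (f w - f z) / (w - z) / c ∈ slitPlane :=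
    eventually_nhdsWithin_iff.1 (hg.eventually (isOpen_slitPlane.mem_nhds one_mem_slitPlane))
  obtain ⟨ρ, hρ, hball⟩ := Metric.eventually_nhds_iff_ball.1 (h1.and hcont)
  refine mem_of_superset (Ioo_mem_nhdsGT hρ) fun r ⟨hr0, hrρ⟩ => ?_
  have hmem : ∀ t, circleMap z r t ∈ Metric.ball z ρ := fun t => by
    simp [Metric.mem_ball, circleMap, abs_of_pos hr0, hrρ]
  have hne : ∀ t, circleMap z r t - z ≠ 0 := fun t => by
    simp [circleMap, hr0.ne']
  have hslit : ∀ t, (f (circleMap z r t) - f z) / (circleMap z r t - z) / c ∈ slitPlane :=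
    fun t => (hball _ (hmem t)).1 (sub_ne_zero.1 (hne t))
  have hmul : ∀ t, f (circleMap z r t) - f z =
      (circleMap z r t - z) * (c * ((f (circleMap z r t) - f z) / (circleMap z r t - z) / c)) :=
    fun t => by have := hne t; field_simp
  refine ⟨fun t => t + arg c + arg ((f (circleMap z r t) - f z) / (circleMap z r t - z) / c),
    ?_, ?_, ?_⟩
  · refine Continuous.continuousOn (continuous_iff_continuousAt.2 fun t => ?_)
    refine (continuousAt_id.add continuousAt_const).add
      (ContinuousAt.comp (g := arg) (continuousAt_arg (hslit t)) ?_)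
    have hcm : ContinuousAt (circleMap z r) t := (continuous_circleMap z r).continuousAt
    exact (((ContinuousAt.comp (hball _ (hmem t)).2 hcm).sub continuousAt_const).div
      (hcm.sub continuousAt_const) (hne t)).div_const c
  · intro t _
    have hs := slitPlane_ne_zero (hslit t)
    have key := hmul t
    set q := (f (circleMap z r t) - f z) / (circleMap z r t - z) / c with hq
    refine ⟨?_, ?_⟩
    · change f (circleMap z r t) - f z ≠ 0
      rw [key]
      exact mul_ne_zero (hne t) (mul_ne_zero hc hs)
    · change f (circleMap z r t) - f z =
        ‖f (circleMap z r t) - f z‖ * exp (((t + arg c + arg q : ℝ) : ℂ) * I)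
      rw [key, norm_mul, norm_mul]
      have e1 : circleMap z r t - z = r * exp (t * I) := by simp [circleMap]
      have e2 := norm_mul_exp_arg_mul_I c
      have e3 := norm_mul_exp_arg_mul_I q
      rw [e1, norm_mul, norm_exp_ofReal_mul_I, mul_one, norm_real, Real.norm_of_nonneg hr0.le]
      push_cast
      rw [add_mul, add_mul, exp_add, exp_add]
      calc (r : ℂ) * exp (t * I) * (c * q)
          = r * exp (t * I) * ((‖c‖ * exp (arg c * I)) * (‖q‖ * exp (arg q * I))) := by
            rw [e2, e3]
        _ = _ := by ring
  · have hper : circleMap z r (2 * Real.pi) = circleMap z r 0 := by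
      simpa using periodic_circleMap z r 0
    simp only [hper]
    push_cast
    ring

/-- Two functions that are both biholomorphic functions of one local coordinate `ℓ` differ by a
transition map with nonzero complex derivative. -/
theorem exists_hasDerivAt_transition {X : Type*} [TopologicalSpace X] {x : X} {ℓ φ ψ : X → ℂ}
    (hℓ : Filter.map ℓ (𝓝 x) = 𝓝 (ℓ x)) {h k : ℂ → ℂ} {a b : ℂ}
    (hh : HasStrictDerivAt h a (ℓ x)) (ha : a ≠ 0) (hk : HasStrictDerivAt k b (ℓ x)) (hb : b ≠ 0)
    (hφ : φ =ᶠ[𝓝 x] h ∘ ℓ) (hψ : ψ =ᶠ[𝓝 x] k ∘ ℓ) {τ : ℂ → ℂ}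
    (hτ : ∀ᶠ y in 𝓝 x, τ (φ y) = ψ y) :
    ∃ c, c ≠ 0 ∧ HasDerivAt τ c (φ x) := by
  have hcomp : ∀ᶠ z in 𝓝 (ℓ x), τ (h z) = k z := by
    rw [← hℓ, Filter.eventually_map]
    filter_upwards [hφ, hψ, hτ] with y h1 h2 h3
    rw [← Function.comp_apply (f := h), ← h1, h3, h2, Function.comp_apply]
  have hinv := hh.to_localInverse ha
  set g := hh.localInverse h a (ℓ x) ha with hg
  have hgx : g (h (ℓ x)) = ℓ x := HasStrictFDerivAt.localInverse_apply_image _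
  have hright : ∀ᶠ w in 𝓝 (h (ℓ x)), h (g w) = w :=
    HasStrictFDerivAt.eventually_right_inverse (hh.hasStrictFDerivAt_equiv ha)
  have hgt : Filter.Tendsto g (𝓝 (h (ℓ x))) (𝓝 (ℓ x)) := by
    simpa [hgx] using hinv.hasDerivAt.continuousAt.tendsto
  have hev : τ =ᶠ[𝓝 (h (ℓ x))] k ∘ g := by
    filter_upwards [hright, hgt.eventually hcomp] with w h1 h2
    rw [h1] at h2
    exact h2
  refine ⟨b * a⁻¹, mul_ne_zero hb (inv_ne_zero ha), ?_⟩
  have hx : φ x = h (ℓ x) := hφ.self_of_nhds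
  rw [hx]
  have hk' : HasDerivAt k b (g (h (ℓ x))) := by rw [hgx]; exact hk.hasDerivAt
  exact (hk'.comp _ hinv.hasDerivAt).congr_of_eventuallyEq hev

/-- A continuous open map on an open set whose fibres there are exactly the fibres of an open
quotient map `q` descends to a chart of the quotient. -/
theorem IsOpenQuotientMap.exists_openPartialHomeomorph {X Q Y : Type*} [TopologicalSpace X]
    [TopologicalSpace Q] [TopologicalSpace Y] {q : X → Q} (hq : IsOpenQuotientMap q)
    [Nonempty X] {U : Set X} (hU : IsOpen U) {φ : X → Y} (hc : ContinuousOn φ U)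
    (ho : ∀ x ∈ U, 𝓝 (φ x) ≤ Filter.map φ (𝓝 x))
    (hfib : ∀ x ∈ U, ∀ y ∈ U, φ x = φ y ↔ q x = q y) :
    ∃ e : OpenPartialHomeomorph Q Y, e.source = q '' U ∧ ∀ x ∈ U, e (q x) = φ x := by
  classical
  have : Nonempty Q := ‹Nonempty X›.map q
  obtain ⟨x₀⟩ := ‹Nonempty X›
  set ψ : Q → Y := fun p => if h : ∃ x ∈ U, q x = p then φ h.choose else φ x₀ with hψ
  have hval : ∀ x ∈ U, ψ (q x) = φ x := fun x hx => by
    have h : ∃ y ∈ U, q y = q x := ⟨x, hx, rfl⟩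
    simp only [hψ, dif_pos h]
    exact (hfib _ h.choose_spec.1 _ hx).2 h.choose_spec.2
  have hinj : InjOn ψ (q '' U) := by
    rintro _ ⟨x, hx, rfl⟩ _ ⟨y, hy, rfl⟩ h
    rw [hval x hx, hval y hy] at h
    exact (hfib x hx y hy).1 h
  have hQU : IsOpen (q '' U) := hq.isOpenMap U hU
  have hcont : ContinuousOn ψ (q '' U) := by
    rintro _ ⟨x, hx, rfl⟩
    refine ContinuousAt.continuousWithinAt ?_
    have hmap : Filter.map q (𝓝 x) = 𝓝 (q x) :=
      le_antisymm hq.continuous.continuousAt (hq.isOpenMap.nhds_le x)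
    rw [ContinuousAt, ← hmap, Filter.tendsto_map'_iff, hval x hx]
    refine (hc.continuousAt (hU.mem_nhds hx)).tendsto.congr' ?_
    filter_upwards [hU.mem_nhds hx] with y hy
    exact (hval y hy).symm
  have hopen : IsOpenMap ((q '' U).domRestrict ψ) := by
    rw [isOpenMap_iff_nhds_le]
    rintro ⟨_, x, hx, rfl⟩
    change 𝓝 (ψ (q x)) ≤ _
    rw [hval x hx]
    refine (ho x hx).trans fun s hs => ?_
    rw [Filter.mem_map] at hs ⊢
    obtain ⟨t, ht, hts⟩ := (mem_nhds_subtype _ _ _).1 hs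
    have h1 : q ⁻¹' t ∈ 𝓝 x := hq.continuous.continuousAt ht
    filter_upwards [h1, hU.mem_nhds hx] with y hy1 hyU
    have := @hts ⟨q y, y, hyU, rfl⟩ hy1
    simpa [hval y hyU] using this
  refine ⟨OpenPartialHomeomorph.ofContinuousOpenRestrict (hinj.toPartialEquiv ψ (q '' U))
    hcont hopen hQU, rfl, fun x hx => hval x hx⟩

/-! ### The topology of the moment-angle complex -/

theorem ZMod.add_one_ne_self {n : ℕ} (hn : 3 ≤ n) (k : ZMod n) : k + 1 ≠ k := by
  have : Fact (1 < n) := ⟨by omega⟩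
  simp

theorem ZMod.sub_one_ne_self {n : ℕ} (hn : 3 ≤ n) (k : ZMod n) : k - 1 ≠ k := by
  have : Fact (1 < n) := ⟨by omega⟩
  simp

theorem ZMod.add_one_ne_sub_one {n : ℕ} (hn : 3 ≤ n) (k : ZMod n) : k + 1 ≠ k - 1 := by
  intro h
  have h2 : ((2 : ℕ) : ZMod n) = 0 := by
    have : k + 1 - (k - 1) = 0 := sub_eq_zero.2 h
    push_cast
    linear_combination this
  rw [ZMod.natCast_eq_zero_iff] at h2
  exact absurd (Nat.le_of_dvd two_pos h2) (by omega)

section Topology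

variable {n : ℕ}

theorem mem_polygonMomentAngle_iff {x : ZMod n → ℝ} : x ∈ polygonMomentAngle n ↔
    (∀ j, |x j| ≤ 1) ∧ ∃ i, ∀ j, j ≠ i → j ≠ i + 1 → |x j| = 1 := by
  constructor
  · rintro ⟨σ, hσ, h1, h2⟩
    simp only [mem_closedBall_zero_iff, mem_sphere_zero_iff_norm, Real.norm_eq_abs] at h1 h2
    refine ⟨fun j => ?_, ?_⟩
    · by_cases hj : j ∈ σ
      · exact h1 j hj
      · exact (h2 j hj).le
    · rcases hσ with rfl | ⟨-, i, hi⟩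
      · exact ⟨0, fun j _ _ => h2 j (by simp)⟩
      · refine ⟨i, fun j hji hji' => h2 j fun hj => ?_⟩
        have := hi hj
        simp only [Finset.mem_insert, Finset.mem_singleton] at this
        tauto
  · rintro ⟨h1, i, hi⟩
    refine ⟨{i, i + 1}, Or.inr ⟨by simp, i, le_rfl⟩, fun j _ => by simpa using h1 j,
      fun j hj => ?_⟩
    simp only [Finset.mem_insert, Finset.mem_singleton, not_or] at hj
    simpa using hi j hj.1 hj.2

theorem abs_coord_le_one (x : polygonMomentAngle n) (j : ZMod n) : |x.1 j| ≤ 1 :=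
  (mem_polygonMomentAngle_iff.1 x.2).1 j

@[simp]
theorem polygonMomentAngle.vadd_apply (g : ZMod n) (x : polygonMomentAngle n) (j : ZMod n) :
    (g +ᵥ x).1 j = x.1 (j + g) := rfl

theorem continuous_coord (j : ZMod n) : Continuous fun x : polygonMomentAngle n => x.1 j :=
  (continuous_apply j).comp continuous_subtype_val

instance polygonMomentAngle.instContinuousConstVAdd :
    ContinuousConstVAdd (ZMod n) (polygonMomentAngle n) where
  continuous_const_vadd g :=
    Continuous.subtype_mk (continuous_pi fun j => continuous_coord (j + g)) _

theorem isCompact_polygonMomentAngle [NeZero n] : IsCompact (polygonMomentAngle n) := by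
  have hclosed : IsClosed (polygonMomentAngle n) := by
    have : polygonMomentAngle n = (⋂ j, {x | |x j| ≤ 1}) ∩
        ⋃ i, ⋂ j, ⋂ (_ : j ≠ i), ⋂ (_ : j ≠ i + 1), {x | |x j| = 1} := by
      ext x
      simp [mem_polygonMomentAngle_iff]
    rw [this]
    refine IsClosed.inter (isClosed_iInter fun j => ?_) (isClosed_iUnion_of_finite fun i =>
      isClosed_iInter fun j => isClosed_iInter fun _ => isClosed_iInter fun _ => ?_)
    · exact isClosed_le (continuous_apply j).abs continuous_const
    · exact isClosed_eq (continuous_apply j).abs continuous_const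
  have hcube := isCompact_univ_pi fun _ : ZMod n => isCompact_Icc (a := (-1 : ℝ)) (b := 1)
  exact hcube.of_isClosed_subset hclosed fun x hx j _ =>
    abs_le.1 ((mem_polygonMomentAngle_iff.1 hx).1 j)

theorem joinedIn_polygonMomentAngle {x y : ZMod n → ℝ} (hx : ∀ j, |x j| ≤ 1) (hy : ∀ j, |y j| ≤ 1)
    (i : ZMod n) (h : ∀ j, j ≠ i → j ≠ i + 1 → |x j| = 1 ∧ y j = x j) :
    JoinedIn (polygonMomentAngle n) x y := by
  refine JoinedIn.of_segment_subset ?_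
  rintro _ ⟨a, b, ha, hb, hab, rfl⟩
  refine mem_polygonMomentAngle_iff.2 ⟨fun j => ?_, i, fun j h1 h2 => ?_⟩
  · exact abs_le.2 ((convex_Icc (-1 : ℝ) 1) (abs_le.1 (hx j)) (abs_le.1 (hy j)) ha hb hab)
  · obtain ⟨h3, h4⟩ := h j h1 h2
    simp only [Pi.add_apply, Pi.smul_apply, smul_eq_mul, h4]
    rw [← add_mul, hab, one_mul, h3]

/-- Every point of the complex is joined to a vertex within a square, and the vertices are joined
to `(1, …, 1)` by changing the signs one by one along edges. -/
theorem isPathConnected_polygonMomentAngle [NeZero n] : IsPathConnected (polygonMomentAngle n) := by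
  classical
  refine ⟨1, mem_polygonMomentAngle_iff.2 ⟨fun j => by simp, 0, fun j _ _ => by simp⟩, ?_⟩
  intro x hx
  obtain ⟨h1, i, hi⟩ := mem_polygonMomentAngle_iff.1 hx
  set v : ZMod n → ℝ := fun j => if j = i ∨ j = i + 1 then 1 else x j with hv
  have hv1 : ∀ j, |v j| = 1 := fun j => by
    simp only [hv]
    split_ifs with h
    · simp
    · push Not at h
      exact hi j h.1 h.2
  have hxv : JoinedIn (polygonMomentAngle n) x v :=
    joinedIn_polygonMomentAngle h1 (fun j => (hv1 j).le) i
      fun j h2 h3 => ⟨hi j h2 h3, by simp [hv, h2, h3]⟩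
  have hs : ∀ s : Finset (ZMod n),
      JoinedIn (polygonMomentAngle n) v (fun j => if j ∈ s then 1 else v j) := by
    intro s
    induction s using Finset.induction_on with
    | empty =>
      refine joinedIn_polygonMomentAngle (fun j => (hv1 j).le) (fun j => ?_) 0 fun j _ _ => ?_
      · simp [hv1]
      · simp [hv1]
    | insert a s ha ih =>
      refine ih.trans (joinedIn_polygonMomentAngle (fun j => ?_) (fun j => ?_) a fun j h2 _ => ?_)
      · split_ifs <;> simp [hv1]
      · split_ifs <;> simp [hv1]
      · simp only [Finset.mem_insert, h2, false_or, and_true]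
        split_ifs <;> simp [hv1]
  have h := hxv.trans (hs Finset.univ)
  simp only [Finset.mem_univ, if_true] at h
  exact h.symm

end Topology

/-! ### Flat coordinates along the edges -/

section FlatCoordinates

variable {n : ℕ}

/-- The retraction of the line onto `[-1, 1]`. -/
noncomputable def clamp (r : ℝ) : ℝ := max (-1) (min 1 r)

theorem continuous_clamp : Continuous clamp := by unfold clamp; fun_prop

theorem abs_clamp_le (r : ℝ) : |clamp r| ≤ 1 :=
  abs_le.2 ⟨le_max_left _ _, max_le (by norm_num) (min_le_left _ _)⟩

theorem clamp_of_abs_le {r : ℝ} (h : |r| ≤ 1) : clamp r = r := by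
  rw [abs_le] at h
  rw [clamp, min_eq_right h.2, max_eq_right h.1]

theorem clamp_of_one_le {r : ℝ} (h : 1 ≤ r) : clamp r = 1 := by
  rw [clamp, min_eq_left h, max_eq_right (by norm_num)]

theorem clamp_sub_clamp {t : ℝ} (h : |t| ≤ 2) : clamp (1 + t) - clamp (1 - t) = t := by
  rw [abs_le] at h
  rcases le_total 0 t with h0 | h0
  · rw [clamp_of_one_le (by linarith), clamp_of_abs_le (abs_le.2 ⟨by linarith, by linarith⟩)]
    ring
  · rw [clamp_of_one_le (r := 1 - t) (by linarith),
      clamp_of_abs_le (abs_le.2 ⟨by linarith, by linarith⟩)]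
    ring

theorem eq_of_abs_eq_one_of_ne_neg {a e : ℝ} (ha : |a| = 1) (he : |e| = 1) (h : a ≠ -e) :
    a = e :=
  (abs_eq_abs.1 (ha.trans he.symm)).resolve_right h

theorem mul_self_of_abs_eq_one {e : ℝ} (he : |e| = 1) : e * e = 1 := by
  rw [← abs_mul_abs_self, he, one_mul]

/-- The open star of the edge in direction `k` whose other coordinates have the signs `ε`: the union
of the open edge and the two open squares adjacent to it. The value `ε k` plays no role. -/
def edgeStar (k : ZMod n) (ε : ZMod n → ℝ) : Set (polygonMomentAngle n) :=
  {x | |x.1 k| < 1 ∧ ∀ j, j ≠ k → x.1 j ≠ -ε j}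

/-- The flat coordinate on the star of an edge: it unfolds the two squares adjacent to the edge
into a rectangle in the plane. The sign in front of the imaginary part orients the squares, so
that these coordinates differ from each other by orientation preserving motions. -/
noncomputable def edgeCoord [NeZero n] (k : ZMod n) (ε : ZMod n → ℝ)
    (x : polygonMomentAngle n) : ℂ :=
  ⟨x.1 k, (∏ j ∈ Finset.univ.erase k, ε j) *
    (ε (k + 1) * x.1 (k + 1) - ε (k - 1) * x.1 (k - 1))⟩

theorem abs_prod_erase [NeZero n] {ε : ZMod n → ℝ} (hε : ∀ j, |ε j| = 1) (k : ZMod n) :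
    |∏ j ∈ Finset.univ.erase k, ε j| = 1 := by
  rw [Finset.abs_prod]
  exact Finset.prod_eq_one fun j _ => hε j

theorem continuous_edgeCoord [NeZero n] (k : ZMod n) (ε : ZMod n → ℝ) :
    Continuous (edgeCoord k ε) := by
  have h : edgeCoord k ε = fun x => Complex.equivRealProdCLM.symm (x.1 k,
      (∏ j ∈ Finset.univ.erase k, ε j) *
        (ε (k + 1) * x.1 (k + 1) - ε (k - 1) * x.1 (k - 1))) := by
    funext x
    rfl
  rw [h]
  refine Complex.equivRealProdCLM.symm.continuous.comp ((continuous_coord k).prodMk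
    (continuous_const.mul ((continuous_const.mul (continuous_coord _)).sub
      (continuous_const.mul (continuous_coord _)))))

theorem isOpen_edgeStar [NeZero n] (k : ZMod n) (ε : ZMod n → ℝ) : IsOpen (edgeStar k ε) := by
  have : edgeStar k ε = {x | |x.1 k| < 1} ∩ ⋂ j, ⋂ (_ : j ≠ k), {x | x.1 j ≠ -ε j} := by
    ext x
    simp [edgeStar]
  rw [this]
  refine (isOpen_lt (continuous_coord k).abs continuous_const).inter
    (isOpen_iInter_of_finite fun j => isOpen_iInter_of_finite fun _ =>
      isOpen_ne_fun (continuous_coord j) continuous_const)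

/-- If the coordinate `k` is not a sign, then at most one further coordinate is not a sign, and it
is one of the two neighbours of `k`. -/
theorem abs_eq_one_of_abs_lt_one {x : polygonMomentAngle n} {k : ZMod n} (hk : |x.1 k| < 1) :
    (∀ j, j ≠ k → j ≠ k + 1 → |x.1 j| = 1) ∨ (∀ j, j ≠ k → j ≠ k - 1 → |x.1 j| = 1) := by
  obtain ⟨-, i, hi⟩ := mem_polygonMomentAngle_iff.1 x.2
  by_cases h1 : k = i
  · subst h1
    exact Or.inl hi
  · by_cases h2 : k = i + 1
    · subst h2
      exact Or.inr fun j h3 h4 => hi j (by simpa using h4) h3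
    · exact absurd (hi k h1 h2) hk.ne

theorem edgeStar_cases {ε : ZMod n → ℝ} (hε : ∀ j, |ε j| = 1) {k : ZMod n}
    {x : polygonMomentAngle n} (hx : x ∈ edgeStar k ε) :
    (∀ j, j ≠ k → j ≠ k + 1 → x.1 j = ε j) ∨ (∀ j, j ≠ k → j ≠ k - 1 → x.1 j = ε j) := by
  refine (abs_eq_one_of_abs_lt_one hx.1).imp ?_ ?_ <;>
  exact fun h j h1 h2 => eq_of_abs_eq_one_of_ne_neg (h j h1 h2) (hε j) (hx.2 j h1)

open Classical in
/-- The inverse of the flat coordinate on the star of an edge, extended to the whole plane by means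
of the retraction onto `[-1, 1]`. -/
noncomputable def edgeSection [NeZero n] (k : ZMod n) (ε : ZMod n → ℝ) (z : ℂ) (j : ZMod n) : ℝ :=
  if j = k then clamp z.re
  else if j = k + 1 then ε j * clamp (1 + (∏ j ∈ Finset.univ.erase k, ε j) * z.im)
  else if j = k - 1 then ε j * clamp (1 - (∏ j ∈ Finset.univ.erase k, ε j) * z.im)
  else ε j

theorem continuous_edgeSection [NeZero n] (k : ZMod n) (ε : ZMod n → ℝ) :
    Continuous (edgeSection k ε) := by
  refine continuous_pi fun j => ?_
  unfold edgeSection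
  have := continuous_clamp
  split_ifs <;> fun_prop

theorem edgeSection_mem [NeZero n] {ε : ZMod n → ℝ} (hε : ∀ j, |ε j| = 1) (k : ZMod n) (z : ℂ) :
    edgeSection k ε z ∈ polygonMomentAngle n := by
  set t := (∏ j ∈ Finset.univ.erase k, ε j) * z.im with ht
  refine mem_polygonMomentAngle_iff.2 ⟨fun j => ?_, ?_⟩
  · unfold edgeSection
    split_ifs
    · exact abs_clamp_le _
    · rw [abs_mul, hε, one_mul]
      exact abs_clamp_le _
    · rw [abs_mul, hε, one_mul]
      exact abs_clamp_le _
    · exact (hε j).le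
  · rcases le_total 0 t with h0 | h0
    · refine ⟨k - 1, fun j h1 h2 => ?_⟩
      rw [sub_add_cancel] at h2
      simp only [edgeSection, if_neg h2, if_neg h1]
      split_ifs
      · rw [← ht, clamp_of_one_le (by linarith), mul_one, hε]
      · exact hε j
    · refine ⟨k, fun j h1 h2 => ?_⟩
      simp only [edgeSection, if_neg h2, if_neg h1]
      split_ifs
      · rw [← ht, clamp_of_one_le (by linarith), mul_one, hε]
      · exact hε j

theorem edgeSection_edgeCoord [NeZero n] (hn : 3 ≤ n) {ε : ZMod n → ℝ} (hε : ∀ j, |ε j| = 1)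
    {k : ZMod n} {x : polygonMomentAngle n} (hx : x ∈ edgeStar k ε) :
    edgeSection k ε (edgeCoord k ε x) = x.1 := by
  have hs := mul_self_of_abs_eq_one (abs_prod_erase hε k)
  have e1 := mul_self_of_abs_eq_one (hε (k + 1))
  have e2 := mul_self_of_abs_eq_one (hε (k - 1))
  have hu : ∀ j, |ε j * x.1 j| ≤ 1 := fun j => by
    rw [abs_mul, hε, one_mul]
    exact abs_coord_le_one x j
  have hback : ∀ j, ε j * (ε j * x.1 j) = x.1 j := fun j => by
    rw [← mul_assoc, mul_self_of_abs_eq_one (hε j), one_mul]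
  funext j
  simp only [edgeSection, edgeCoord, ← mul_assoc, hs]
  rcases edgeStar_cases hε hx with h | h
  · have h3 : x.1 (k - 1) = ε (k - 1) :=
      h _ (ZMod.sub_one_ne_self hn k) (ZMod.add_one_ne_sub_one hn k).symm
    rw [h3, e2]
    split_ifs with h4 h5 h6
    · rw [h4, clamp_of_abs_le (abs_coord_le_one x k)]
    · subst h5
      rw [show 1 + 1 * (ε (k + 1) * x.1 (k + 1) - 1) = ε (k + 1) * x.1 (k + 1) by ring,
        clamp_of_abs_le (hu _), hback]
    · subst h6
      have := (abs_le.1 (hu (k + 1))).2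
      rw [clamp_of_one_le (by linarith), h3, mul_one]
    · exact (h j h4 h5).symm
  · have h3 : x.1 (k + 1) = ε (k + 1) :=
      h _ (ZMod.add_one_ne_self hn k) (ZMod.add_one_ne_sub_one hn k)
    rw [h3, e1]
    split_ifs with h4 h5 h6
    · rw [h4, clamp_of_abs_le (abs_coord_le_one x k)]
    · subst h5
      have := (abs_le.1 (hu (k - 1))).2
      rw [clamp_of_one_le (by linarith), h3, mul_one]
    · subst h6
      rw [show 1 - 1 * (1 - ε (k - 1) * x.1 (k - 1)) = ε (k - 1) * x.1 (k - 1) by ring,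
        clamp_of_abs_le (hu _), hback]
    · exact (h j h4 h6).symm

theorem edgeCoord_edgeSection [NeZero n] (hn : 3 ≤ n) {ε : ZMod n → ℝ} (hε : ∀ j, |ε j| = 1)
    {k : ZMod n} {z : ℂ} (hre : |z.re| ≤ 1) (him : |z.im| ≤ 2) :
    edgeCoord k ε ⟨edgeSection k ε z, edgeSection_mem hε k z⟩ = z := by
  have hs := mul_self_of_abs_eq_one (abs_prod_erase hε k)
  have e1 := mul_self_of_abs_eq_one (hε (k + 1))
  have e2 := mul_self_of_abs_eq_one (hε (k - 1))
  apply Complex.ext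
  · simp [edgeCoord, edgeSection, clamp_of_abs_le hre]
  · simp only [edgeCoord, edgeSection, if_neg (ZMod.add_one_ne_self hn k),
      if_neg (ZMod.sub_one_ne_self hn k), if_neg (ZMod.add_one_ne_sub_one hn k).symm, if_true]
    rw [← mul_assoc, ← mul_assoc, e1, e2, one_mul, one_mul, clamp_sub_clamp, ← mul_assoc, hs,
      one_mul]
    rw [abs_mul, abs_prod_erase hε, one_mul]
    exact him

theorem injOn_edgeCoord [NeZero n] (hn : 3 ≤ n) {ε : ZMod n → ℝ} (hε : ∀ j, |ε j| = 1)
    (k : ZMod n) : InjOn (edgeCoord k ε) (edgeStar k ε) := fun x hx y hy h => by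
  apply Subtype.ext
  rw [← edgeSection_edgeCoord hn hε hx, ← edgeSection_edgeCoord hn hε hy, h]

theorem map_edgeCoord_nhds [NeZero n] (hn : 3 ≤ n) {ε : ZMod n → ℝ} (hε : ∀ j, |ε j| = 1)
    {k : ZMod n} {x : polygonMomentAngle n} (hx : x ∈ edgeStar k ε) :
    Filter.map (edgeCoord k ε) (𝓝 x) = 𝓝 (edgeCoord k ε x) := by
  refine le_antisymm (continuous_edgeCoord k ε).continuousAt ?_
  set r : ℂ → polygonMomentAngle n := fun z => ⟨edgeSection k ε z, edgeSection_mem hε k z⟩ with hr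
  have hrc : Continuous r := Continuous.subtype_mk (continuous_edgeSection k ε) _
  have hrx : r (edgeCoord k ε x) = x := Subtype.ext (edgeSection_edgeCoord hn hε hx)
  have hre : |(edgeCoord k ε x).re| < 1 := hx.1
  have him : |(edgeCoord k ε x).im| < 2 := by
    simp only [edgeCoord]
    rw [abs_mul, abs_prod_erase hε, one_mul]
    have hu : ∀ j, |ε j * x.1 j| ≤ 1 := fun j => by
      rw [abs_mul, hε, one_mul]
      exact abs_coord_le_one x j
    have hlt : ∀ j, j ≠ k → -1 < ε j * x.1 j := fun j hj => by
      refine lt_of_le_of_ne (abs_le.1 (hu j)).1 fun h => hx.2 j hj ?_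
      have := mul_self_of_abs_eq_one (hε j)
      linear_combination (-x.1 j) * this - ε j * h
    have h1 := hlt _ (ZMod.add_one_ne_self hn k)
    have h2 := hlt _ (ZMod.sub_one_ne_self hn k)
    have h3 := (abs_le.1 (hu (k + 1))).2
    have h4 := (abs_le.1 (hu (k - 1))).2
    exact abs_lt.2 ⟨by linarith, by linarith⟩
  have hev : edgeCoord k ε ∘ r =ᶠ[𝓝 (edgeCoord k ε x)] id := by
    have o1 : IsOpen {z : ℂ | |z.re| < 1} := isOpen_lt (by fun_prop) continuous_const
    have o2 : IsOpen {z : ℂ | |z.im| < 2} := isOpen_lt (by fun_prop) continuous_const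
    filter_upwards [o1.mem_nhds hre, o2.mem_nhds him] with z h1 h2
    exact edgeCoord_edgeSection hn hε (le_of_lt h1) (le_of_lt h2)
  calc 𝓝 (edgeCoord k ε x) = Filter.map (edgeCoord k ε ∘ r) (𝓝 (edgeCoord k ε x)) := by
        rw [Filter.map_congr hev, Filter.map_id]
    _ = Filter.map (edgeCoord k ε) (Filter.map r (𝓝 (edgeCoord k ε x))) := Filter.map_map.symm
    _ ≤ Filter.map (edgeCoord k ε) (𝓝 x) := by
        refine Filter.map_mono ?_
        have := hrc.continuousAt (x := edgeCoord k ε x)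
        rwa [ContinuousAt, hrx] at this

end FlatCoordinates

/-! ### The flat conformal structure -/

section FlatStructure

variable {n : ℕ}

/-- Over a square in the directions `i`, `i + 1`, each of the flat coordinates of the edges of that
square is a complex affine function of one and the same coordinate. The factor `-iτ` for the
direction `i + 1` is a rotation by a right angle; this is where the sign in the definition of
`edgeCoord` matters. -/
theorem edgeCoord_eq_affine_of_square [NeZero n] (hn : 3 ≤ n) {ε : ZMod n → ℝ}
    (hε : ∀ j, |ε j| = 1) {i k : ZMod n} (hk : k = i ∨ k = i + 1) :
    ∃ c d : ℂ, c ≠ 0 ∧ ∀ y ∈ edgeStar k ε, |y.1 i| < 1 → |y.1 (i + 1)| < 1 →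
      edgeCoord k ε y =
        c * ⟨y.1 i, (∏ j ∈ (Finset.univ.erase i).erase (i + 1), ε j) * y.1 (i + 1)⟩ + d := by
  set τ := ∏ j ∈ (Finset.univ.erase i).erase (i + 1), ε j with hτ
  have hττ : τ * τ = 1 := by
    refine mul_self_of_abs_eq_one ?_
    rw [hτ, Finset.abs_prod]
    exact Finset.prod_eq_one fun j _ => hε j
  have e0 := mul_self_of_abs_eq_one (hε i)
  have e1 := mul_self_of_abs_eq_one (hε (i + 1))
  have hs0 : ∏ j ∈ Finset.univ.erase i, ε j = ε (i + 1) * τ :=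
    (Finset.mul_prod_erase _ _ (by simp [ZMod.add_one_ne_self hn])).symm
  have hs1 : ∏ j ∈ Finset.univ.erase (i + 1), ε j = ε i * τ := by
    rw [hτ, Finset.erase_right_comm]
    exact (Finset.mul_prod_erase _ _ (by simp [(ZMod.add_one_ne_self hn i).symm])).symm
  have hother : ∀ y ∈ edgeStar k ε, |y.1 i| < 1 → |y.1 (i + 1)| < 1 →
      ∀ j, j ≠ i → j ≠ i + 1 → y.1 j = ε j := by
    intro y hy h0 h1 j hj0 hj1
    have hjk : j ≠ k := by rcases hk with rfl | rfl <;> assumption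
    rcases abs_eq_one_of_abs_lt_one h0 with h | h
    · exact eq_of_abs_eq_one_of_ne_neg (h j hj0 hj1) (hε j) (hy.2 j hjk)
    · exact absurd (h _ (ZMod.add_one_ne_self hn i) (ZMod.add_one_ne_sub_one hn i)) h1.ne
  rcases hk with rfl | rfl
  · refine ⟨1, ⟨0, -(ε (k + 1) * τ)⟩, one_ne_zero, fun y hy h0 h1 => ?_⟩
    have h2 := hother y hy h0 h1 (k - 1) (ZMod.sub_one_ne_self hn k)
      (ZMod.add_one_ne_sub_one hn k).symm
    have e2 := mul_self_of_abs_eq_one (hε (k - 1))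
    apply Complex.ext
    · simp [edgeCoord]
    · simp only [edgeCoord, hs0, h2, one_mul, Complex.add_im]
      linear_combination (τ * y.1 (k + 1)) * e1 - (ε (k + 1) * τ) * e2
  · refine ⟨⟨0, -τ⟩, ⟨0, ε i * τ⟩, fun h => ?_, fun y hy h0 h1 => ?_⟩
    · have : -τ = 0 := congrArg Complex.im h
      rw [neg_eq_zero.1 this] at hττ
      simp at hττ
    · have h2 := hother y hy h0 h1 (i + 1 + 1)
        (fun h => ZMod.add_one_ne_sub_one hn (i + 1) (by rw [h]; ring))
        (ZMod.add_one_ne_self hn (i + 1))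
      have e2 := mul_self_of_abs_eq_one (hε (i + 1 + 1))
      apply Complex.ext
      · simp only [edgeCoord, Complex.add_re, Complex.mul_re]
        linear_combination (-y.1 (i + 1)) * hττ
      · simp only [edgeCoord, hs1, h2, add_sub_cancel_right, Complex.add_im, Complex.mul_im]
        linear_combination (ε i * τ) * e2 - (τ * y.1 i) * e0

/-- Any two flat coordinates defined at a point differ near it by a complex affine map. -/
theorem edgeCoord_compatible [NeZero n] (hn : 3 ≤ n) {ε δ : ZMod n → ℝ} (hε : ∀ j, |ε j| = 1)
    (hδ : ∀ j, |δ j| = 1) {k l : ZMod n} {x : polygonMomentAngle n} (hx : x ∈ edgeStar k ε)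
    (hx' : x ∈ edgeStar l δ) :
    ∃ c d : ℂ, c ≠ 0 ∧ ∀ᶠ y in 𝓝 x, edgeCoord l δ y = c * edgeCoord k ε y + d := by
  -- Either `x` is an interior point of a square, or it lies on the edge itself, and then both
  -- coordinates come from that edge.
  by_cases hsq : ∃ j, j ≠ k ∧ |x.1 j| < 1
  · obtain ⟨j, hjk, hj⟩ := hsq
    obtain ⟨-, i, hi⟩ := mem_polygonMomentAngle_iff.1 x.2
    have hmem : ∀ m, |x.1 m| < 1 → m = i ∨ m = i + 1 := fun m hm => by
      by_contra h
      push Not at h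
      exact hm.ne (hi m h.1 h.2)
    have hi01 : |x.1 i| < 1 ∧ |x.1 (i + 1)| < 1 := by
      have hk := hx.1
      rcases hmem j hj with rfl | rfl <;> rcases hmem k hk with rfl | rfl
      · exact absurd rfl hjk
      · exact ⟨hj, hk⟩
      · exact ⟨hk, hj⟩
      · exact absurd rfl hjk
    obtain ⟨c, d, hc, h1⟩ := edgeCoord_eq_affine_of_square hn hε (hmem k hx.1)
    obtain ⟨c', d', hc', h2⟩ := edgeCoord_eq_affine_of_square hn hδ (hmem l hx'.1)
    have hprod : ∏ j ∈ (Finset.univ.erase i).erase (i + 1), δ j =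
        ∏ j ∈ (Finset.univ.erase i).erase (i + 1), ε j := by
      refine Finset.prod_congr rfl fun m hm => ?_
      simp only [Finset.mem_erase, Finset.mem_univ, and_true] at hm
      have hm1 : |x.1 m| = 1 := hi m hm.2 hm.1
      have hmk : m ≠ k := by rintro rfl; exact hx.1.ne hm1
      have hml : m ≠ l := by rintro rfl; exact hx'.1.ne hm1
      rw [← eq_of_abs_eq_one_of_ne_neg hm1 (hε m) (hx.2 m hmk),
        ← eq_of_abs_eq_one_of_ne_neg hm1 (hδ m) (hx'.2 m hml)]
    refine ⟨c' / c, d' - c' / c * d, div_ne_zero hc' hc, ?_⟩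
    filter_upwards [(isOpen_edgeStar k ε).mem_nhds hx, (isOpen_edgeStar l δ).mem_nhds hx',
      (isOpen_lt (continuous_coord i).abs continuous_const).mem_nhds hi01.1,
      (isOpen_lt (continuous_coord (i + 1)).abs continuous_const).mem_nhds hi01.2] with
      y hy1 hy2 hy3 hy4
    rw [h1 y hy1 hy3 hy4, h2 y hy2 hy3 hy4, hprod]
    field_simp
    ring
  · push Not at hsq
    have hone : ∀ j, j ≠ k → |x.1 j| = 1 := fun j hj =>
      le_antisymm (abs_coord_le_one x j) (hsq j hj)
    have hkl : l = k := by
      by_contra h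
      exact hx'.1.ne (hone l h)
    subst hkl
    have heq : ∀ j, j ≠ l → δ j = ε j := fun j hj => by
      rw [← eq_of_abs_eq_one_of_ne_neg (hone j hj) (hε j) (hx.2 j hj),
        ← eq_of_abs_eq_one_of_ne_neg (hone j hj) (hδ j) (hx'.2 j hj)]
    refine ⟨1, 0, one_ne_zero, Filter.Eventually.of_forall fun y => ?_⟩
    rw [one_mul, add_zero]
    simp only [edgeCoord, heq _ (ZMod.add_one_ne_self hn l), heq _ (ZMod.sub_one_ne_self hn l)]
    rw [Finset.prod_congr rfl fun j hj => heq j (Finset.ne_of_mem_erase hj)]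

theorem edgeCoord_vadd [NeZero n] (g k : ZMod n) (ε : ZMod n → ℝ) (x : polygonMomentAngle n) :
    edgeCoord (k - g) (fun j => ε (j + g)) (g +ᵥ x) = edgeCoord k ε x := by
  have h : ∏ j ∈ Finset.univ.erase (k - g), ε (j + g) = ∏ j ∈ Finset.univ.erase k, ε j :=
    Finset.prod_equiv (Equiv.addRight g) (by simp [eq_sub_iff_add_eq]) (by simp)
  simp only [edgeCoord, h, polygonMomentAngle.vadd_apply]
  rw [sub_add_cancel, show k - g + 1 + g = k + 1 by ring, show k - g - 1 + g = k - 1 by ring]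

theorem vadd_mem_edgeStar {g k : ZMod n} {ε : ZMod n → ℝ} {x : polygonMomentAngle n}
    (hx : x ∈ edgeStar k ε) : g +ᵥ x ∈ edgeStar (k - g) (fun j => ε (j + g)) := by
  refine ⟨by simpa using hx.1, fun j hj => hx.2 (j + g) fun h => hj ?_⟩
  rw [← h, add_sub_cancel_right]

theorem exists_mem_edgeStar {x : polygonMomentAngle n} (hx : ∃ k, |x.1 k| < 1) :
    ∃ k ε, (∀ j, |ε j| = 1) ∧ x ∈ edgeStar k ε := by
  obtain ⟨k, hk⟩ := hx
  refine ⟨k, fun j => if 0 ≤ x.1 j then 1 else -1, fun j => ?_, hk, fun j _ => ?_⟩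
  · dsimp only
    split_ifs <;> simp
  · dsimp only
    split_ifs <;> intro h <;> linarith

/-- The function `φ` is, near `x`, a biholomorphic function of the flat coordinates. -/
def IsFlatBiholomorphicAt [NeZero n] (φ : polygonMomentAngle n → ℂ)
    (x : polygonMomentAngle n) : Prop :=
  ∀ k ε, (∀ j, |ε j| = 1) → x ∈ edgeStar k ε →
    ∃ (h : ℂ → ℂ) (c : ℂ), HasStrictDerivAt h c (edgeCoord k ε x) ∧ c ≠ 0 ∧
      φ =ᶠ[𝓝 x] h ∘ edgeCoord k ε

namespace IsFlatBiholomorphicAt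

variable [NeZero n] {φ ψ : polygonMomentAngle n → ℂ} {x : polygonMomentAngle n}

/-- As flat coordinates are compatible, it suffices to look at one of them. -/
theorem of_edgeCoord (hn : 3 ≤ n) {k : ZMod n} {ε : ZMod n → ℝ} (hε : ∀ j, |ε j| = 1)
    (hx : x ∈ edgeStar k ε) {h : ℂ → ℂ} {c : ℂ} (hh : HasStrictDerivAt h c (edgeCoord k ε x))
    (hc : c ≠ 0) (hφ : φ =ᶠ[𝓝 x] h ∘ edgeCoord k ε) : IsFlatBiholomorphicAt φ x := by
  intro l δ hδ hx'
  obtain ⟨a, b, ha, hab⟩ := edgeCoord_compatible hn hδ hε hx' hx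
  have hlin : HasStrictDerivAt (fun z : ℂ => a * z + b) a (edgeCoord l δ x) := by
    simpa using ((hasStrictDerivAt_id (edgeCoord l δ x)).const_mul a).add_const b
  rw [hab.self_of_nhds] at hh
  refine ⟨fun z => h (a * z + b), c * a,
    HasStrictDerivAt.comp (h := fun z => a * z + b) _ hh hlin, mul_ne_zero hc ha, ?_⟩
  filter_upwards [hφ, hab] with y h1 h2
  rw [h1, Function.comp_apply, Function.comp_apply, h2]

theorem of_vadd (hinv : ∀ (g : ZMod n) y, φ (g +ᵥ y) = φ y) {g : ZMod n}
    (h : IsFlatBiholomorphicAt φ (g +ᵥ x)) : IsFlatBiholomorphicAt φ x := by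
  intro k ε hε hx
  obtain ⟨f, c, hf, hc, hφ⟩ := h (k - g) (fun j => ε (j + g)) (fun j => hε _)
    (vadd_mem_edgeStar hx)
  rw [edgeCoord_vadd] at hf
  refine ⟨f, c, hf, hc, ?_⟩
  have hg : Filter.Tendsto (fun y : polygonMomentAngle n => g +ᵥ y) (𝓝 x) (𝓝 (g +ᵥ x)) :=
    (continuous_const_vadd g).continuousAt
  filter_upwards [hg.eventually hφ] with y hy
  rw [← hinv g y, hy, Function.comp_apply, edgeCoord_vadd, Function.comp_apply]

theorem congr (h : IsFlatBiholomorphicAt φ x) (hφ : ψ =ᶠ[𝓝 x] φ) : IsFlatBiholomorphicAt ψ x :=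
  fun k ε hε hx =>
    let ⟨f, c, hf, hc, h1⟩ := h k ε hε hx
    ⟨f, c, hf, hc, hφ.trans h1⟩

theorem map_nhds_eq (hn : 3 ≤ n) (h : IsFlatBiholomorphicAt φ x) (hx : ∃ k, |x.1 k| < 1) :
    Filter.map φ (𝓝 x) = 𝓝 (φ x) := by
  obtain ⟨k, ε, hε, hxk⟩ := exists_mem_edgeStar hx
  obtain ⟨f, c, hf, hc, hφ⟩ := h k ε hε hxk
  rw [Filter.map_congr hφ, ← Filter.map_map, map_edgeCoord_nhds hn hε hxk, hf.map_nhds_eq hc,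
    hφ.self_of_nhds, Function.comp_apply]

theorem exists_hasDerivAt (hn : 3 ≤ n) (h : IsFlatBiholomorphicAt φ x)
    (h' : IsFlatBiholomorphicAt ψ x) (hx : ∃ k, |x.1 k| < 1) {τ : ℂ → ℂ}
    (hτ : ∀ᶠ y in 𝓝 x, τ (φ y) = ψ y) : ∃ c, c ≠ 0 ∧ HasDerivAt τ c (φ x) := by
  obtain ⟨k, ε, hε, hxk⟩ := exists_mem_edgeStar hx
  obtain ⟨f, a, hf, ha, hφ⟩ := h k ε hε hxk
  obtain ⟨f', b, hf', hb, hψ⟩ := h' k ε hε hxk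
  exact exists_hasDerivAt_transition (map_edgeCoord_nhds hn hε hxk) hf ha hf' hb hφ hψ hτ

end IsFlatBiholomorphicAt

end FlatStructure

/-! ### Cone coordinates at the vertices -/

section ConeCoordinates

variable {n : ℕ}

/-- The group of rotations that fix a sign vector `ε`, i.e. the stabilizer of the vertex `ε`. -/
def periodSubgroup (ε : ZMod n → ℝ) : AddSubgroup (ZMod n) where
  carrier := {g | ∀ j, ε (j + g) = ε j}
  add_mem' {g h} hg hh j := by rw [← add_assoc, hh, hg]
  zero_mem' j := by rw [add_zero]
  neg_mem' {g} hg j := by rw [← hg (j + -g), neg_add_cancel_right]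

theorem mem_periodSubgroup {ε : ZMod n → ℝ} {g : ZMod n} :
    g ∈ periodSubgroup ε ↔ ∀ j, ε (j + g) = ε j := Iff.rfl

/-- In the cyclic group `ZMod n` a subgroup is determined by its order. -/
theorem mem_iff_card_nsmul_eq_zero [NeZero n] (H : AddSubgroup (ZMod n)) (g : ZMod n) :
    g ∈ H ↔ Nat.card H • g = 0 := by
  classical
  constructor
  · intro hg
    exact congrArg Subtype.val (card_nsmul_eq_zero' (x := (⟨g, hg⟩ : H)))
  · intro hg
    have hsub : (Finset.univ.filter fun a : ZMod n => a ∈ H) ⊆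
        Finset.univ.filter fun a : ZMod n => Nat.card H • a = 0 := by
      intro a ha
      simp only [Finset.mem_filter, Finset.mem_univ, true_and] at ha ⊢
      exact congrArg Subtype.val (card_nsmul_eq_zero' (x := (⟨a, ha⟩ : H)))
    have hcard : (Finset.univ.filter fun a : ZMod n => a ∈ H).card = Nat.card H := by
      rw [Nat.card_eq_fintype_card, Fintype.card_subtype]
    have heq := Finset.eq_of_subset_of_card_le hsub
      ((IsAddCyclic.card_nsmul_eq_zero_le Nat.card_pos).trans hcard.ge)
    have : g ∈ Finset.univ.filter fun a : ZMod n => a ∈ H := by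
      rw [heq]
      simpa using hg
    simpa using this

/-- The neighbourhood of the vertex `ε` formed by the points at which no coordinate has changed its
sign. -/
def vertexStar (ε : ZMod n → ℝ) : Set (polygonMomentAngle n) := {x | ∀ j, 0 < ε j * x.1 j}

/-- The two squares adjacent to the edge in direction `k` at the vertex `ε`, unfolded into a half
plane with the vertex at the origin and the edge on the positive real axis. -/
def coneCoord (ε : ZMod n → ℝ) (k : ZMod n) (x : polygonMomentAngle n) : ℂ :=
  ⟨1 - ε k * x.1 k, ε (k - 1) * x.1 (k - 1) - ε (k + 1) * x.1 (k + 1)⟩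

/-- There are `n` squares at a vertex, `n / m` if those related by the stabilizer, of order `m`, are
identified. With this exponent the right angles of these squares fill up the full angle. -/
noncomputable def coneExponent (ε : ZMod n → ℝ) : ℝ := 4 * Nat.card (periodSubgroup ε) / n

/-- The half plane around the `k`-th edge, bent into a sector of the cone. -/
noncomputable def conePower [NeZero n] (ε : ZMod n → ℝ) (k : ZMod n) (z : ℂ) : ℂ :=
  ZMod.stdAddChar k ^ Nat.card (periodSubgroup ε) * z ^ (coneExponent ε : ℂ)

open Classical in
/-- The coordinate on the cone of squares around a vertex `ε` modulo the stabilizer of `ε`; the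
vertex is the origin. On each sector, any of the edges with `ε k * x k < 1` may be used. -/
noncomputable def coneChart [NeZero n] (ε : ZMod n → ℝ) (x : polygonMomentAngle n) : ℂ :=
  if h : ∃ k, ε k * x.1 k < 1 then conePower ε h.choose (coneCoord ε h.choose x) else 0

variable {ε : ZMod n → ℝ}

theorem coneExponent_pos [NeZero n] (ε : ZMod n → ℝ) : 0 < coneExponent ε := by
  have h1 : 0 < Nat.card (periodSubgroup ε) := Nat.card_pos
  have h2 : 0 < n := Nat.pos_of_neZero n
  unfold coneExponent
  positivity

theorem isOpen_vertexStar [NeZero n] (ε : ZMod n → ℝ) : IsOpen (vertexStar ε) := by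
  have : vertexStar ε = ⋂ j, {x | 0 < ε j * x.1 j} := by
    ext x
    simp [vertexStar]
  rw [this]
  exact isOpen_iInter_of_finite fun j =>
    isOpen_lt continuous_const (continuous_const.mul (continuous_coord j))

theorem sign_mul_coord_le_one (hε : ∀ j, |ε j| = 1) (x : polygonMomentAngle n) (j : ZMod n) :
    ε j * x.1 j ≤ 1 := by
  refine (le_abs_self _).trans ?_
  rw [abs_mul, hε, one_mul]
  exact abs_coord_le_one x j

theorem sign_mul_coord_eq_one (hε : ∀ j, |ε j| = 1) {x : polygonMomentAngle n}
    (hx : x ∈ vertexStar ε) {j : ZMod n} (hj : |x.1 j| = 1) : ε j * x.1 j = 1 := by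
  rw [← abs_of_pos (hx j), abs_mul, hε, hj, one_mul]

theorem abs_coord_lt_one (hε : ∀ j, |ε j| = 1) {x : polygonMomentAngle n}
    (hx : x ∈ vertexStar ε) {j : ZMod n} (hj : ε j * x.1 j < 1) : |x.1 j| < 1 :=
  lt_of_le_of_ne (abs_coord_le_one x j) fun h => hj.ne (sign_mul_coord_eq_one hε hx h)

theorem mem_edgeStar_of_mem_vertexStar (hε : ∀ j, |ε j| = 1) {x : polygonMomentAngle n}
    (hx : x ∈ vertexStar ε) {k : ZMod n} (hk : ε k * x.1 k < 1) : x ∈ edgeStar k ε := by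
  refine ⟨abs_coord_lt_one hε hx hk, fun j _ h => ?_⟩
  have h1 := hx j
  rw [h, mul_neg, mul_self_of_abs_eq_one (hε j)] at h1
  linarith

theorem exists_sign_mul_coord_lt_one (hε : ∀ j, |ε j| = 1) {x : polygonMomentAngle n}
    (h : x.1 ≠ ε) : ∃ k, ε k * x.1 k < 1 := by
  by_contra! h'
  refine h (funext fun j => ?_)
  have h1 := le_antisymm (sign_mul_coord_le_one hε x j) (h' j)
  have h2 := mul_self_of_abs_eq_one (hε j)
  linear_combination ε j * h1 - x.1 j * h2

/-- Away from the vertex, each point of the star lies in a half-open sector: the one between the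
edges `k` (included) and `k + 1` (excluded). -/
theorem exists_sector (hε : ∀ j, |ε j| = 1) {x : polygonMomentAngle n}
    (hx : x ∈ vertexStar ε) (h : x.1 ≠ ε) :
    ∃ k, ε k * x.1 k < 1 ∧ ∀ j, j ≠ k → j ≠ k + 1 → ε j * x.1 j = 1 := by
  obtain ⟨k, hk⟩ := exists_sign_mul_coord_lt_one hε h
  obtain ⟨-, i, hi⟩ := mem_polygonMomentAngle_iff.1 x.2
  have hi' : ∀ j, j ≠ i → j ≠ i + 1 → ε j * x.1 j = 1 := fun j h1 h2 =>
    sign_mul_coord_eq_one hε hx (hi j h1 h2)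
  rcases (sign_mul_coord_le_one hε x i).lt_or_eq with h0 | h0
  · exact ⟨i, h0, hi'⟩
  · have hki : k = i + 1 := by
      by_contra h1
      refine hk.ne (hi' k (fun h2 => ?_) h1)
      rw [h2] at hk
      exact hk.ne h0
    subst hki
    refine ⟨i + 1, hk, fun j h1 _ => ?_⟩
    by_cases h3 : j = i
    · rw [h3, h0]
    · exact hi' j h3 h1

theorem continuous_coneCoord (ε : ZMod n → ℝ) (k : ZMod n) : Continuous (coneCoord ε k) := by
  have h : coneCoord ε k = fun x => Complex.equivRealProdCLM.symm (1 - ε k * x.1 k,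
      ε (k - 1) * x.1 (k - 1) - ε (k + 1) * x.1 (k + 1)) := by
    funext x
    rfl
  rw [h]
  exact Complex.equivRealProdCLM.symm.continuous.comp
    ((continuous_const.sub (continuous_const.mul (continuous_coord k))).prodMk
      ((continuous_const.mul (continuous_coord _)).sub
      (continuous_const.mul (continuous_coord _))))

theorem stdAddChar_pow_eq_exp [NeZero n] (a : ℤ) (m : ℕ) :
    (ZMod.stdAddChar (a : ZMod n) : ℂ) ^ m =
      Complex.exp (((2 * Real.pi * m * a / n : ℝ) : ℂ) * Complex.I) := by
  rw [ZMod.stdAddChar_coe, ← Complex.exp_nat_mul]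
  congr 1
  push_cast
  ring

theorem conePower_eq_exp [NeZero n] (ε : ZMod n → ℝ) (a : ℤ) {z : ℂ} (hz : z ≠ 0) :
    conePower ε (a : ZMod n) z = Complex.exp
      (((2 * Real.pi * Nat.card (periodSubgroup ε) * a / n : ℝ) : ℂ) * Complex.I +
        Complex.log z * coneExponent ε) := by
  rw [conePower, stdAddChar_pow_eq_exp, Complex.cpow_def_of_ne_zero hz, Complex.exp_add]

/-- Consecutive sectors fit together: turning by a right angle in the half plane is turning by one
sector in the cone. -/
theorem conePower_add_one [NeZero n] (ε : ZMod n → ℝ) (k : ZMod n) {z : ℂ} (hre : 0 < z.re)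
    (him : 0 < z.im) : conePower ε (k + 1) (-Complex.I * z) = conePower ε k z := by
  obtain ⟨a, rfl⟩ := ZMod.intCast_surjective k
  have hz : z ≠ 0 := fun h => by simp [h] at hre
  have hn : (n : ℝ) ≠ 0 := Nat.cast_ne_zero.2 (NeZero.ne n)
  have harg : -(Real.pi / 2) + z.arg ∈ Ioc (-Real.pi) Real.pi := by
    have h1 := Complex.arg_nonneg_iff.2 him.le
    have h2 := Complex.arg_le_pi z
    have h3 := Real.pi_pos
    exact ⟨by linarith, by linarith⟩
  have hlog : Complex.log (-Complex.I * z) = -(Real.pi / 2 * Complex.I) + Complex.log z := by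
    rw [(Complex.log_mul_eq_add_log_iff (by simp) hz).2 (by rwa [Complex.arg_neg_I]),
      Complex.log_neg_I]
    ring
  have hcast : ((a : ZMod n) + 1) = ((a + 1 : ℤ) : ZMod n) := by push_cast; rfl
  rw [hcast, conePower_eq_exp ε _ (mul_ne_zero (by simp) hz), conePower_eq_exp ε _ hz, hlog]
  congr 1
  have hn' : (n : ℂ) ≠ 0 := Nat.cast_ne_zero.2 (NeZero.ne n)
  rw [coneExponent]
  push_cast
  field_simp
  ring

theorem coneCoord_add_one (hn : 3 ≤ n) (hε : ∀ j, |ε j| = 1) {x : polygonMomentAngle n}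
    (hx : x ∈ vertexStar ε) {k : ZMod n} (hk : ε k * x.1 k < 1)
    (hk' : ε (k + 1) * x.1 (k + 1) < 1) :
    coneCoord ε (k + 1) x = -Complex.I * coneCoord ε k x ∧ 0 < (coneCoord ε k x).im := by
  have hone : ∀ j, j ≠ k → j ≠ k + 1 → ε j * x.1 j = 1 := fun j h1 h2 => by
    rcases abs_eq_one_of_abs_lt_one (abs_coord_lt_one hε hx hk) with h | h
    · exact sign_mul_coord_eq_one hε hx (h j h1 h2)
    · exact absurd (sign_mul_coord_eq_one hε hx
        (h _ (ZMod.add_one_ne_self hn k) (ZMod.add_one_ne_sub_one hn k))) hk'.ne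
  have h1 := hone (k - 1) (ZMod.sub_one_ne_self hn k) (ZMod.add_one_ne_sub_one hn k).symm
  have h2 := hone (k + 1 + 1)
    (fun h => ZMod.add_one_ne_sub_one hn (k + 1) (by rw [h]; ring))
    (ZMod.add_one_ne_self hn (k + 1))
  refine ⟨Complex.ext ?_ ?_, ?_⟩
  · simp [coneCoord, h1]
  · simp only [coneCoord, add_sub_cancel_right, h2, Complex.mul_im, Complex.neg_im,
      Complex.neg_re, Complex.I_re, Complex.I_im]
    ring
  · simp only [coneCoord, h1]
    linarith

theorem coneChart_eq_conePower [NeZero n] (hn : 3 ≤ n) (hε : ∀ j, |ε j| = 1)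
    {x : polygonMomentAngle n} (hx : x ∈ vertexStar ε) {k : ZMod n} (hk : ε k * x.1 k < 1) :
    coneChart ε x = conePower ε k (coneCoord ε k x) := by
  have hadj : ∀ i, ε i * x.1 i < 1 → ε (i + 1) * x.1 (i + 1) < 1 →
      conePower ε (i + 1) (coneCoord ε (i + 1) x) = conePower ε i (coneCoord ε i x) := by
    intro i h0 h1
    obtain ⟨h2, h3⟩ := coneCoord_add_one hn hε hx h0 h1
    rw [h2]
    exact conePower_add_one ε i (by simpa [coneCoord] using h0) h3
  have h : ∃ k, ε k * x.1 k < 1 := ⟨k, hk⟩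
  rw [coneChart, dif_pos h]
  have hl := h.choose_spec
  set l := h.choose
  obtain ⟨-, i, hi⟩ := mem_polygonMomentAngle_iff.1 x.2
  have hmem : ∀ m, ε m * x.1 m < 1 → m = i ∨ m = i + 1 := fun m hm => by
    by_contra h
    push Not at h
    exact (abs_coord_lt_one hε hx hm).ne (hi m h.1 h.2)
  rcases hmem k hk with h1 | h1 <;> rcases hmem l hl with h2 | h2 <;> rw [h1] at hk ⊢ <;>
    rw [h2] at hl ⊢
  · exact hadj i hk hl
  · exact (hadj i hl hk).symm

theorem coneChart_vertex [NeZero n] (hε : ∀ j, |ε j| = 1) {x : polygonMomentAngle n}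
    (hx : x.1 = ε) : coneChart ε x = 0 := by
  rw [coneChart, dif_neg]
  rintro ⟨k, hk⟩
  rw [hx, mul_self_of_abs_eq_one (hε k)] at hk
  exact lt_irrefl _ hk

theorem norm_conePower [NeZero n] (ε : ZMod n → ℝ) (k : ZMod n) (z : ℂ) :
    ‖conePower ε k z‖ = ‖z‖ ^ coneExponent ε := by
  rw [conePower, norm_mul, norm_pow, ZMod.stdAddChar_apply, Circle.norm_coe, one_pow, one_mul,
    Complex.norm_cpow_real]

theorem conePower_ne_zero [NeZero n] (ε : ZMod n → ℝ) (k : ZMod n) {z : ℂ} (hz : 0 < z.re) :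
    conePower ε k z ≠ 0 := by
  have hz0 : z ≠ 0 := fun h => by simp [h] at hz
  rw [← norm_pos_iff, norm_conePower]
  exact Real.rpow_pos_of_pos (norm_pos_iff.2 hz0) _

theorem coneChart_eq_zero_iff [NeZero n] (hn : 3 ≤ n) (hε : ∀ j, |ε j| = 1)
    {x : polygonMomentAngle n} (hx : x ∈ vertexStar ε) : coneChart ε x = 0 ↔ x.1 = ε := by
  refine ⟨fun h => ?_, coneChart_vertex hε⟩
  by_contra hne
  obtain ⟨k, hk⟩ := exists_sign_mul_coord_lt_one hε hne
  rw [coneChart_eq_conePower hn hε hx hk] at h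
  exact conePower_ne_zero ε k (by simpa [coneCoord] using hk) h

theorem norm_coneChart_le [NeZero n] (hn : 3 ≤ n) (hε : ∀ j, |ε j| = 1)
    {x v : polygonMomentAngle n} (hv : v.1 = ε) (hx : x ∈ vertexStar ε) :
    ‖coneChart ε x‖ ≤ (2 * dist x v) ^ coneExponent ε := by
  by_cases hxε : x.1 = ε
  · rw [coneChart_vertex hε hxε, norm_zero]
    positivity
  · obtain ⟨k, hk, hj⟩ := exists_sector hε hx hxε
    rw [coneChart_eq_conePower hn hε hx hk, norm_conePower]
    refine Real.rpow_le_rpow (norm_nonneg _) ?_ (coneExponent_pos ε).le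
    have hd : ∀ j, |1 - ε j * x.1 j| ≤ dist x v := fun j => by
      have h1 : 1 - ε j * x.1 j = -(ε j * (x.1 j - ε j)) := by
        linear_combination -mul_self_of_abs_eq_one (hε j)
      rw [h1, abs_neg, abs_mul, hε, one_mul]
      have := dist_le_pi_dist x.1 v.1 j
      rw [Real.dist_eq] at this
      rwa [← hv]
    have h1 := hj (k - 1) (ZMod.sub_one_ne_self hn k) (ZMod.add_one_ne_sub_one hn k).symm
    refine (Complex.norm_le_abs_re_add_abs_im _).trans ?_
    simp only [coneCoord, h1]
    linarith [hd k, hd (k + 1)]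

theorem continuousOn_coneChart [NeZero n] (hn : 3 ≤ n) (hε : ∀ j, |ε j| = 1) :
    ContinuousOn (coneChart ε) (vertexStar ε) := by
  intro x hx
  have hU := (isOpen_vertexStar ε).mem_nhds hx
  refine ContinuousAt.continuousWithinAt ?_
  by_cases hxε : x.1 = ε
  · rw [ContinuousAt, coneChart_vertex hε hxε]
    refine squeeze_zero_norm' (a := fun y => (2 * dist y x) ^ coneExponent ε) ?_ ?_
    · filter_upwards [hU] with y hy
      exact norm_coneChart_le hn hε hxε hy
    · have h1 : Continuous fun y : polygonMomentAngle n => 2 * dist y x := by fun_prop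
      have h2 := (h1.rpow_const fun _ => Or.inr (coneExponent_pos ε).le).tendsto x
      simpa [Real.zero_rpow (coneExponent_pos ε).ne'] using h2
  · obtain ⟨k, hk⟩ := exists_sign_mul_coord_lt_one hε hxε
    have hk' : IsOpen {y : polygonMomentAngle n | ε k * y.1 k < 1} :=
      isOpen_lt (continuous_const.mul (continuous_coord k)) continuous_const
    have hev : coneChart ε =ᶠ[𝓝 x] fun y => conePower ε k (coneCoord ε k y) := by
      filter_upwards [hU, hk'.mem_nhds hk] with y h1 h2
      exact coneChart_eq_conePower hn hε h1 h2
    refine ContinuousAt.congr ?_ hev.symm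
    unfold conePower
    refine continuousAt_const.mul (ContinuousAt.cpow (continuous_coneCoord ε k).continuousAt
      continuousAt_const (Or.inl ?_))
    simpa [coneCoord] using hk

/-- The cone coordinate takes all sufficiently small values close to the vertex. -/
theorem exists_coneChart_eq [NeZero n] (hn : 3 ≤ n) (hε : ∀ j, |ε j| = 1) {δ : ℝ} (hδ : 0 < δ)
    (hδ1 : δ ≤ 1) {w : ℂ} (hw : ‖w‖ < δ ^ coneExponent ε) :
    ∃ x : polygonMomentAngle n, (∀ j, |x.1 j - ε j| < δ) ∧ coneChart ε x = w := by
  classical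
  rcases eq_or_ne w 0 with rfl | hw0
  · refine ⟨⟨ε, mem_polygonMomentAngle_iff.2 ⟨fun j => (hε j).le, 0, fun j _ _ => hε j⟩⟩,
      fun j => by simpa using hδ, coneChart_vertex hε rfl⟩
  set α := coneExponent ε with hα
  have hαpos : 0 < α := coneExponent_pos ε
  set m := Nat.card (periodSubgroup ε) with hm
  have hm0 : (m : ℝ) ≠ 0 := Nat.cast_ne_zero.2 Nat.card_pos.ne'
  have hn0 : (n : ℝ) ≠ 0 := Nat.cast_ne_zero.2 (NeZero.ne n)
  have hpi := Real.pi_pos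
  -- The argument of `w`, measured in sectors: its integral part is the index of the sector.
  set q : ℝ := w.arg * n / (2 * Real.pi * m) with hq
  set ψ : ℝ := Real.pi / 2 * Int.fract q with hψ
  have hψ0 : 0 ≤ ψ := mul_nonneg (by positivity) (Int.fract_nonneg q)
  have hψ1 : ψ < Real.pi / 2 := by
    have := mul_lt_mul_of_pos_left (Int.fract_lt_one q) (half_pos hpi)
    rwa [mul_one] at this
  set E : ℂ := Complex.exp (((Real.log ‖w‖ / α : ℝ) : ℂ) + ψ * Complex.I) with hE
  have hlogE : Complex.log E = ((Real.log ‖w‖ / α : ℝ) : ℂ) + ψ * Complex.I := by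
    rw [hE, Complex.log_exp]
    · simp only [Complex.add_im, Complex.ofReal_im, Complex.mul_im, Complex.ofReal_re,
        Complex.I_im, Complex.I_re]
      linarith
    · simp only [Complex.add_im, Complex.ofReal_im, Complex.mul_im, Complex.ofReal_re,
        Complex.I_im, Complex.I_re]
      linarith
  have hEre : 0 < E.re := by
    rw [hE, Complex.exp_re]
    refine mul_pos (Real.exp_pos _) (Real.cos_pos_of_mem_Ioo ⟨?_, ?_⟩) <;> simp <;> linarith
  have hEim : 0 ≤ E.im := by
    rw [hE, Complex.exp_im]
    refine mul_nonneg (Real.exp_pos _).le (Real.sin_nonneg_of_nonneg_of_le_pi ?_ ?_) <;> simp <;>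
      linarith
  have hEnorm : ‖E‖ < δ := by
    have h1 : Real.log ‖w‖ < α * Real.log δ := by
      rw [← Real.log_rpow hδ]
      exact Real.log_lt_log (norm_pos_iff.2 hw0) hw
    rw [hE, Complex.norm_exp, ← Real.lt_log_iff_exp_lt hδ]
    simpa [div_lt_iff₀ hαpos, mul_comm] using h1
  have hE1 : E.re < δ := (Complex.re_le_norm E).trans_lt hEnorm
  have hE2 : E.im < δ := (Complex.im_le_norm E).trans_lt hEnorm
  set k : ZMod n := ((⌊q⌋ : ℤ) : ZMod n) with hk
  set u : ZMod n → ℝ := fun j => if j = k then 1 - E.re else if j = k + 1 then 1 - E.im else 1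
    with hu
  have huk : u k = 1 - E.re := by simp [hu]
  have huk1 : u (k + 1) = 1 - E.im := by simp [hu, ZMod.add_one_ne_self hn k]
  have hother : ∀ j, j ≠ k → j ≠ k + 1 → u j = 1 := fun j h1 h2 => by simp [hu, h1, h2]
  have hu0 : ∀ j, 0 < u j ∧ u j ≤ 1 ∧ 1 - u j < δ := fun j => by
    by_cases h1 : j = k
    · rw [h1, huk]
      exact ⟨by linarith, by linarith, by linarith⟩
    · by_cases h2 : j = k + 1
      · rw [h2, huk1]
        exact ⟨by linarith, by linarith, by linarith⟩
      · rw [hother j h1 h2]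
        exact ⟨by linarith, by linarith, by linarith⟩
  have hxmem : (fun j => ε j * u j) ∈ polygonMomentAngle n := by
    refine mem_polygonMomentAngle_iff.2 ⟨fun j => ?_, k, fun j h1 h2 => ?_⟩
    · rw [abs_mul, hε, one_mul, abs_of_pos (hu0 j).1]
      exact (hu0 j).2.1
    · rw [hother j h1 h2, mul_one, hε]
  set x : polygonMomentAngle n := ⟨fun j => ε j * u j, hxmem⟩ with hx
  have hux : ∀ j, ε j * x.1 j = u j := fun j => by
    simp only [hx]
    rw [← mul_assoc, mul_self_of_abs_eq_one (hε j), one_mul]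
  have hxU : x ∈ vertexStar ε := fun j => by
    rw [hux]
    exact (hu0 j).1
  refine ⟨x, fun j => ?_, ?_⟩
  · have h1 : x.1 j - ε j = -(ε j * (1 - u j)) := by
      simp only [hx]
      ring
    rw [h1, abs_neg, abs_mul, hε, one_mul, abs_of_nonneg (by linarith [(hu0 j).2.1])]
    exact (hu0 j).2.2
  · have hcoord : coneCoord ε k x = E := by
      have h1 := hother (k - 1) (ZMod.sub_one_ne_self hn k) (ZMod.add_one_ne_sub_one hn k).symm
      apply Complex.ext
      · simp [coneCoord, hux, huk]
      · simp [coneCoord, hux, huk1, h1]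
    have hE0 : E ≠ 0 := Complex.exp_ne_zero _
    rw [coneChart_eq_conePower hn hε hxU (k := k) (by rw [hux, huk]; linarith), hcoord, hk,
      conePower_eq_exp ε _ hE0, hlogE, ← hα, ← hm]
    conv_rhs => rw [← Complex.exp_log hw0]
    congr 1
    have key : 2 * Real.pi * m * ⌊q⌋ / n + ψ * α = w.arg := by
      have h1 : (⌊q⌋ : ℝ) + Int.fract q = q := Int.floor_add_fract q
      have h2 : ψ * α = 2 * Real.pi * m * Int.fract q / n := by
        rw [hψ, hα, coneExponent, ← hm]
        ring
      rw [h2, ← add_div, ← mul_add, h1, hq]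
      field_simp
    have key2 : Real.log ‖w‖ / α * α = Real.log ‖w‖ := by field_simp
    apply Complex.ext
    · simpa [Complex.log_re] using key2
    · simpa [Complex.log_im] using key

/-- Two points of the cone in standard sectors with the same image differ by the rotation through
the sectors, and this is a multiple of the period. -/
theorem eq_of_conePower_eq [NeZero n] {k l : ZMod n} {z w : ℂ} (hz : 0 < z.re) (hz' : 0 ≤ z.im)
    (hw : 0 < w.re) (hw' : 0 ≤ w.im) (h : conePower ε k z = conePower ε l w) :
    z = w ∧ Nat.card (periodSubgroup ε) • (k - l) = 0 := by
  have hz0 : z ≠ 0 := fun h => by simp [h] at hz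
  have hw0 : w ≠ 0 := fun h => by simp [h] at hw
  have hn0 : (n : ℝ) ≠ 0 := Nat.cast_ne_zero.2 (NeZero.ne n)
  have hpi := Real.pi_pos
  have hα := coneExponent_pos ε
  have hnorm : ‖z‖ = ‖w‖ := by
    have h1 := congrArg norm h
    rw [norm_conePower, norm_conePower] at h1
    exact (Real.rpow_left_inj (norm_nonneg _) (norm_nonneg _) hα.ne').1 h1
  obtain ⟨d, hd⟩ := (AddSubgroup.card_addSubgroup_dvd_card (periodSubgroup ε)).trans
    (Nat.card_zmod n).dvd
  obtain ⟨a, rfl⟩ := ZMod.intCast_surjective k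
  obtain ⟨b, rfl⟩ := ZMod.intCast_surjective l
  rw [conePower_eq_exp ε a hz0, conePower_eq_exp ε b hw0, Complex.exp_eq_exp_iff_exists_int] at h
  obtain ⟨N, hN⟩ := h
  have him := congrArg Complex.im hN
  set m := Nat.card (periodSubgroup ε) with hm
  have hm0 : (m : ℝ) ≠ 0 := Nat.cast_ne_zero.2 Nat.card_pos.ne'
  have hnmd : (n : ℝ) = m * d := by exact_mod_cast hd
  have hd0 : (d : ℝ) ≠ 0 := fun h => hn0 (by rw [hnmd, h, mul_zero])
  have him' : 2 * Real.pi * m * a / n + z.arg * coneExponent ε =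
      2 * Real.pi * m * b / n + w.arg * coneExponent ε + N * (2 * Real.pi) := by
    have e1 : (Complex.log z * (coneExponent ε : ℂ)).im = z.arg * coneExponent ε := by
      rw [Complex.im_mul_ofReal, Complex.log_im]
    have e2 : (Complex.log w * (coneExponent ε : ℂ)).im = w.arg * coneExponent ε := by
      rw [Complex.im_mul_ofReal, Complex.log_im]
    have e3 : ((N : ℂ) * (2 * Real.pi * Complex.I)).im = N * (2 * Real.pi) := by simp
    have e4 : ∀ r : ℝ, ((r : ℂ) * Complex.I).im = r := by simp
    rw [Complex.add_im, Complex.add_im, Complex.add_im, e1, e2, e3, e4, e4] at him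
    exact him
  have hscaled : Real.pi / 2 * ((a - b - N * d : ℤ) : ℝ) = w.arg - z.arg := by
    rw [coneExponent, ← hm, hnmd] at him'
    push_cast
    field_simp at him'
    linarith
  have harg : ∀ {z : ℂ}, 0 < z.re → 0 ≤ z.im → 0 ≤ z.arg ∧ z.arg < Real.pi / 2 := by
    intro z h1 h2
    exact ⟨Complex.arg_nonneg_iff.2 h2, Complex.arg_lt_pi_div_two_iff.2 (Or.inl h1)⟩
  obtain ⟨hz1, hz2⟩ := harg hz hz'
  obtain ⟨hw1, hw2⟩ := harg hw hw'
  -- An integer multiple of a right angle that is smaller than a right angle is zero.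
  have hzero : a - b - N * d = 0 := by
    have h1 : ((a - b - N * d : ℤ) : ℝ) < 1 := by
      by_contra! h2
      have := mul_le_mul_of_nonneg_left h2 (half_pos hpi).le
      linarith
    have h3 : (-1 : ℝ) < ((a - b - N * d : ℤ) : ℝ) := by
      by_contra! h2
      have := mul_le_mul_of_nonneg_left h2 (half_pos hpi).le
      linarith
    have h1' : a - b - N * d < 1 := by exact_mod_cast h1
    have h3' : -1 < a - b - N * d := by exact_mod_cast h3
    omega
  have hargs : z.arg = w.arg := by
    rw [hzero, Int.cast_zero, mul_zero] at hscaled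
    linarith
  refine ⟨Complex.ext_norm_arg hnorm hargs, ?_⟩
  have h4 : (a : ZMod n) - b = ((N * d : ℤ) : ZMod n) := by
    rw [← Int.cast_sub]
    congr 1
    omega
  rw [h4, nsmul_eq_mul]
  have h5 : ((m : ZMod n)) * ((N * d : ℤ) : ZMod n) = ((N * (m * d : ℕ) : ℤ) : ZMod n) := by
    push_cast
    ring
  rw [h5, ← hd]
  simp

/-- The fibres of the cone coordinate are the orbits of the rotations. -/
theorem coneChart_eq_iff [NeZero n] (hn : 3 ≤ n) (hε : ∀ j, |ε j| = 1)
    {x y : polygonMomentAngle n} (hx : x ∈ vertexStar ε) (hy : y ∈ vertexStar ε) :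
    coneChart ε x = coneChart ε y ↔ ∃ g : ZMod n, g +ᵥ x = y := by
  constructor
  · intro h
    by_cases hxε : x.1 = ε
    · rw [(coneChart_eq_zero_iff hn hε hx).2 hxε, eq_comm, coneChart_eq_zero_iff hn hε hy] at h
      exact ⟨0, by rw [zero_vadd]; exact Subtype.ext (hxε.trans h.symm)⟩
    · have hyε : y.1 ≠ ε := fun hy' => hxε <| by
        rwa [(coneChart_eq_zero_iff hn hε hy).2 hy', coneChart_eq_zero_iff hn hε hx] at h
      obtain ⟨k, hk, hxj⟩ := exists_sector hε hx hxε
      obtain ⟨l, hl, hyj⟩ := exists_sector hε hy hyε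
      rw [coneChart_eq_conePower hn hε hx hk, coneChart_eq_conePower hn hε hy hl] at h
      have h1 := hxj (k - 1) (ZMod.sub_one_ne_self hn k) (ZMod.add_one_ne_sub_one hn k).symm
      have h2 := hyj (l - 1) (ZMod.sub_one_ne_self hn l) (ZMod.add_one_ne_sub_one hn l).symm
      obtain ⟨hzw, hper⟩ := eq_of_conePower_eq (by simpa [coneCoord] using hk)
        (by simpa [coneCoord, h1] using sign_mul_coord_le_one hε x (k + 1))
        (by simpa [coneCoord] using hl)
        (by simpa [coneCoord, h2] using sign_mul_coord_le_one hε y (l + 1)) h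
      have hg : k - l ∈ periodSubgroup ε := (mem_iff_card_nsmul_eq_zero _ _).2 hper
      have hre := congrArg Complex.re hzw
      have him := congrArg Complex.im hzw
      simp only [coneCoord, h1, h2, sub_right_inj] at hre him
      refine ⟨k - l, Subtype.ext (funext fun j => ?_)⟩
      rw [polygonMomentAngle.vadd_apply]
      have hu : ε (j + (k - l)) * x.1 (j + (k - l)) = ε j * y.1 j := by
        by_cases h3 : j = l
        · rw [h3, add_sub_cancel, hre]
        · by_cases h4 : j = l + 1
          · rw [h4, show l + 1 + (k - l) = k + 1 by ring, him]
          · rw [hyj j h3 h4, hxj]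
            · exact fun h5 => h3 (by linear_combination h5)
            · exact fun h5 => h4 (by linear_combination h5)
      rw [mem_periodSubgroup.1 hg j] at hu
      have h0 : ε j ≠ 0 := fun h => by simpa [h] using hε j
      exact mul_left_cancel₀ h0 hu
  · rintro ⟨g, rfl⟩
    have hg : g ∈ periodSubgroup ε := by
      -- the coordinates of `x` at `j + g` have the signs `ε j` and `ε (j + g)`
      intro j
      have h1 := hx (j + g)
      have h2 := hy j
      rw [polygonMomentAngle.vadd_apply] at h2
      refine eq_of_abs_eq_one_of_ne_neg (hε _) (hε _) fun h3 => ?_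
      rw [h3] at h1
      linarith
    by_cases hxε : x.1 = ε
    · rw [coneChart_vertex hε hxε, coneChart_vertex hε]
      funext j
      rw [polygonMomentAngle.vadd_apply, hxε, hg j]
    · obtain ⟨k, hk⟩ := exists_sign_mul_coord_lt_one hε hxε
      have hε' : ∀ j, ε (j - g) = ε j := fun j => by
        rw [← hg (j - g), sub_add_cancel]
      have hk' : ε (k - g) * (g +ᵥ x).1 (k - g) < 1 := by
        rwa [polygonMomentAngle.vadd_apply, sub_add_cancel, hε']
      rw [coneChart_eq_conePower hn hε hx hk, coneChart_eq_conePower hn hε hy hk']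
      have hcoord : coneCoord ε (k - g) (g +ᵥ x) = coneCoord ε k x := by
        simp only [coneCoord, polygonMomentAngle.vadd_apply]
        rw [show k - g - 1 = k - 1 - g by ring, show k - g + 1 = k + 1 - g by ring, hε', hε', hε',
          sub_add_cancel, sub_add_cancel, sub_add_cancel]
      have hchar : (ZMod.stdAddChar (k - g) : ℂ) ^ Nat.card (periodSubgroup ε) =
          ZMod.stdAddChar k ^ Nat.card (periodSubgroup ε) := by
        rw [← AddChar.map_nsmul_eq_pow, ← AddChar.map_nsmul_eq_pow, nsmul_sub,
          (mem_iff_card_nsmul_eq_zero _ _).1 hg, sub_zero]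
      rw [conePower, conePower, hcoord, hchar]

end ConeCoordinates

/-! ### The atlas of the quotient -/

section Atlas

variable {n : ℕ} {ε : ZMod n → ℝ}

/-- The identity if the product of the signs of the vertex `ε` is `1`, and complex conjugation if
it is `-1`. The cyclic order of the edges at `ε` agrees with the orientation of the surface in the
first case only. -/
noncomputable def orientConj [NeZero n] (ε : ZMod n → ℝ) (z : ℂ) : ℂ :=
  ⟨z.re, (∏ j, ε j) * z.im⟩

theorem orientConj_eq [NeZero n] (hε : ∀ j, |ε j| = 1) :
    (orientConj ε = id ∧ ∏ j, ε j = 1) ∨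
      (orientConj ε = (starRingEnd ℂ : ℂ → ℂ) ∧ ∏ j, ε j = -1) := by
  have h : |∏ j, ε j| = 1 := by
    rw [Finset.abs_prod]
    exact Finset.prod_eq_one fun j _ => hε j
  rcases (abs_eq one_pos.le).1 h with h | h
  · exact Or.inl ⟨funext fun z => by apply Complex.ext <;> simp [orientConj, h], h⟩
  · exact Or.inr ⟨funext fun z => by apply Complex.ext <;> simp [orientConj, h], h⟩

theorem orientConj_involutive [NeZero n] (hε : ∀ j, |ε j| = 1) :
    Function.Involutive (orientConj ε) := by
  rcases orientConj_eq hε with ⟨h, -⟩ | ⟨h, -⟩ <;> rw [h] <;> intro z <;> simp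

theorem continuous_orientConj [NeZero n] (hε : ∀ j, |ε j| = 1) : Continuous (orientConj ε) := by
  rcases orientConj_eq hε with ⟨h, -⟩ | ⟨h, -⟩ <;> rw [h]
  · exact continuous_id
  · exact Complex.continuous_conj

theorem norm_orientConj [NeZero n] (hε : ∀ j, |ε j| = 1) (z : ℂ) : ‖orientConj ε z‖ = ‖z‖ := by
  rcases orientConj_eq hε with ⟨h, -⟩ | ⟨h, -⟩ <;> rw [h] <;> simp

theorem orientConj_mul_cpow [NeZero n] (hε : ∀ j, |ε j| = 1) (c : ℂ) {z : ℂ} (hz : 0 < z.re)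
    (a : ℝ) : orientConj ε (c * z ^ (a : ℂ)) = orientConj ε c * orientConj ε z ^ (a : ℂ) := by
  rcases orientConj_eq hε with ⟨h, -⟩ | ⟨h, -⟩ <;> rw [h]
  · rfl
  · have harg : z.arg ≠ Real.pi := by
      have := Complex.arg_lt_pi_div_two_iff.2 (Or.inl hz)
      have := Real.pi_pos
      linarith
    rw [map_mul, Complex.conj_cpow z a harg, Complex.conj_ofReal]

/-- After conjugation if necessary, the unfolded half plane at a vertex is a complex affine
function of the flat coordinate. -/
theorem orientConj_coneCoord [NeZero n] (k : ZMod n)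
    (x : polygonMomentAngle n) :
    orientConj ε (coneCoord ε k x) = 1 - (ε k : ℂ) * edgeCoord k ε x := by
  have h : ∏ j, ε j = ε k * ∏ j ∈ Finset.univ.erase k, ε j :=
    (Finset.mul_prod_erase _ _ (Finset.mem_univ k)).symm
  apply Complex.ext
  · simp [orientConj, coneCoord, edgeCoord]
  · simp only [orientConj, coneCoord, edgeCoord, h, Complex.sub_im, Complex.one_im,
      Complex.im_ofReal_mul]
    ring

/-- The cone coordinate is conformal away from the vertex. -/
theorem isFlatBiholomorphicAt_coneChart [NeZero n] (hn : 3 ≤ n) (hε : ∀ j, |ε j| = 1)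
    {x : polygonMomentAngle n} (hx : x ∈ vertexStar ε) (hxε : x.1 ≠ ε) :
    IsFlatBiholomorphicAt (orientConj ε ∘ coneChart ε) x := by
  obtain ⟨k, hk⟩ := exists_sign_mul_coord_lt_one hε hxε
  set α := coneExponent ε with hα
  set χ : ℂ := ZMod.stdAddChar k ^ Nat.card (periodSubgroup ε) with hχ
  have hχ0 : orientConj ε χ ≠ 0 := by
    rw [← norm_pos_iff, norm_orientConj hε, hχ, norm_pow, ZMod.stdAddChar_apply, Circle.norm_coe,
      one_pow]
    exact one_pos
  have hεk : (ε k : ℂ) ≠ 0 := fun h => by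
    have h0 : ε k = 0 := by exact_mod_cast h
    simpa [h0] using hε k
  have hslit : 1 - (ε k : ℂ) * edgeCoord k ε x ∈ Complex.slitPlane :=
    Or.inl (by simpa [edgeCoord] using hk)
  have hlin : HasStrictDerivAt (fun z : ℂ => 1 - (ε k : ℂ) * z) (-(ε k : ℂ))
      (edgeCoord k ε x) := by
    simpa using ((hasStrictDerivAt_id (edgeCoord k ε x)).const_mul (ε k : ℂ)).const_sub 1
  have hα0 : (α : ℂ) ≠ 0 := by exact_mod_cast (coneExponent_pos ε).ne'
  refine IsFlatBiholomorphicAt.of_edgeCoord hn hε (mem_edgeStar_of_mem_vertexStar hε hx hk)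
    (h := fun z => orientConj ε χ * (1 - (ε k : ℂ) * z) ^ (α : ℂ))
    ((hlin.cpow_const hslit).const_mul _) ?_ ?_
  · refine mul_ne_zero hχ0 (mul_ne_zero (mul_ne_zero hα0 ?_) (neg_ne_zero.2 hεk))
    rw [Complex.cpow_ne_zero_iff]
    exact Or.inl (Complex.slitPlane_ne_zero hslit)
  · have hk' : IsOpen {y : polygonMomentAngle n | ε k * y.1 k < 1} :=
      isOpen_lt (continuous_const.mul (continuous_coord k)) continuous_const
    filter_upwards [(isOpen_vertexStar ε).mem_nhds hx, hk'.mem_nhds hk] with y h1 h2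
    rw [Function.comp_apply, Function.comp_apply, coneChart_eq_conePower hn hε h1 h2, conePower,
      orientConj_mul_cpow hε _ (by simpa [coneCoord] using h2), orientConj_coneCoord]

theorem nhds_le_map_coneChart [NeZero n] (hn : 3 ≤ n) (hε : ∀ j, |ε j| = 1)
    {x : polygonMomentAngle n} (hx : x ∈ vertexStar ε) :
    𝓝 ((orientConj ε ∘ coneChart ε) x) ≤ Filter.map (orientConj ε ∘ coneChart ε) (𝓝 x) := by
  by_cases hxε : x.1 = ε
  · intro s hs
    obtain ⟨δ, hδ, hball⟩ := Metric.mem_nhds_iff.1 (Filter.mem_map.1 hs)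
    have hδ' : 0 < min δ 1 := lt_min hδ one_pos
    have h0 : (orientConj ε ∘ coneChart ε) x = 0 := by
      rw [← norm_eq_zero, Function.comp_apply, norm_orientConj hε, coneChart_vertex hε hxε,
        norm_zero]
    rw [h0]
    refine Filter.mem_of_superset (Metric.ball_mem_nhds 0
      (Real.rpow_pos_of_pos hδ' (coneExponent ε))) fun w hw => ?_
    rw [mem_ball_zero_iff, ← norm_orientConj hε] at hw
    obtain ⟨y, hy, hyw⟩ := exists_coneChart_eq hn hε hδ' (min_le_right _ _) hw
    have hyx : y ∈ Metric.ball x δ := by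
      rw [Metric.mem_ball, Subtype.dist_eq, dist_pi_lt_iff hδ]
      intro j
      rw [Real.dist_eq, hxε]
      exact (hy j).trans_le (min_le_left _ _)
    have := hball hyx
    rwa [mem_preimage, Function.comp_apply, hyw, orientConj_involutive hε] at this
  · have hk := exists_sign_mul_coord_lt_one hε hxε
    exact ((isFlatBiholomorphicAt_coneChart hn hε hx hxε).map_nhds_eq hn
      (hk.imp fun k hk => abs_coord_lt_one hε hx hk)).ge

/-- A rotation fixes a point other than a vertex only if it is trivial: it would have to shift the
set of coordinates which are not signs, one residue or two consecutive ones, onto itself. -/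
theorem eq_zero_of_vadd_eq_self (hn : 3 ≤ n) {x : polygonMomentAngle n} (hx : ∃ k, |x.1 k| < 1)
    {g : ZMod n} (hg : g +ᵥ x = x) : g = 0 := by
  have hrot : ∀ j, x.1 (j + g) = x.1 j := fun j => congrFun (congrArg Subtype.val hg) j
  obtain ⟨k, hk⟩ := hx
  have h1 : |x.1 (k + g)| < 1 := by rwa [hrot]
  have h2 : |x.1 (k - g)| < 1 := by rwa [← hrot (k - g), sub_add_cancel]
  by_contra hg0
  have hne1 : k + g ≠ k := by simpa using hg0
  have hne2 : k - g ≠ k := by simpa using hg0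
  rcases abs_eq_one_of_abs_lt_one hk with h | h
  · have e1 : k + g = k + 1 := by
      by_contra h3
      exact h1.ne (h _ hne1 h3)
    have e2 : k - g = k + 1 := by
      by_contra h3
      exact h2.ne (h _ hne2 h3)
    exact ZMod.add_one_ne_sub_one hn k (by linear_combination -e1 - e2)
  · have e1 : k + g = k - 1 := by
      by_contra h3
      exact h1.ne (h _ hne1 h3)
    have e2 : k - g = k - 1 := by
      by_contra h3
      exact h2.ne (h _ hne2 h3)
    exact ZMod.add_one_ne_sub_one hn k (by linear_combination e1 + e2)

/-- A point that is not a vertex has a neighbourhood disjoint from all its translates. -/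
theorem exists_isOpen_forall_vadd_ne [NeZero n] (hn : 3 ≤ n) {x : polygonMomentAngle n}
    (hx : ∃ k, |x.1 k| < 1) : ∃ U : Set (polygonMomentAngle n), IsOpen U ∧ x ∈ U ∧
      ∀ y ∈ U, ∀ z ∈ U, ∀ g : ZMod n, g +ᵥ y = z → g = 0 := by
  have h : ∀ᶠ p : polygonMomentAngle n × polygonMomentAngle n in 𝓝 x ×ˢ 𝓝 x,
      ∀ g : ZMod n, g ≠ 0 → g +ᵥ p.1 ≠ p.2 := by
    rw [← nhds_prod_eq, Filter.eventually_all]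
    intro g
    by_cases hg : g = 0
    · simp [hg]
    · have ho : IsOpen {p : polygonMomentAngle n × polygonMomentAngle n | g +ᵥ p.1 ≠ p.2} :=
        isOpen_ne_fun ((continuous_const_vadd g).comp continuous_fst) continuous_snd
      have hmem : (x, x) ∈ {p : polygonMomentAngle n × polygonMomentAngle n | g +ᵥ p.1 ≠ p.2} :=
        fun h => hg (eq_zero_of_vadd_eq_self hn hx h)
      filter_upwards [ho.mem_nhds hmem] with p hp _ using hp
  obtain ⟨s, hs, hsub⟩ := Filter.mem_prod_self_iff.1 h
  obtain ⟨U, hUs, hU, hxU⟩ := mem_nhds_iff.1 hs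
  refine ⟨U, hU, hxU, fun y hy z hz g hg => ?_⟩
  by_contra hg0
  exact hsub (mk_mem_prod (hUs hy) (hUs hz)) g hg0 hg

theorem polygonQuotient_mk_eq_iff {x y : polygonMomentAngle n} :
    (Quotient.mk _ x : PolygonQuotient n) = Quotient.mk _ y ↔ ∃ g : ZMod n, g +ᵥ x = y := by
  rw [eq_comm, Quotient.eq]
  exact Iff.rfl

/-- Every point of the quotient has a chart which is conformal for the flat structure, except
possibly at the given point in case it is a vertex. -/
theorem exists_flat_chart [NeZero n] (hn : 3 ≤ n) (p : PolygonQuotient n) :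
    ∃ e : OpenPartialHomeomorph (PolygonQuotient n) ℂ, p ∈ e.source ∧
      ∀ x : polygonMomentAngle n, (Quotient.mk _ x : PolygonQuotient n) ∈ e.source →
        ((∃ k, |x.1 k| < 1) ∧
          IsFlatBiholomorphicAt (fun y => e (Quotient.mk _ y : PolygonQuotient n)) x) ∨
        (¬ (∃ k, |x.1 k| < 1) ∧ (Quotient.mk _ x : PolygonQuotient n) = p) := by
  obtain ⟨v, rfl⟩ := Quotient.exists_rep p
  have hq : IsOpenQuotientMap (Quotient.mk (AddAction.orbitRel (ZMod n) (polygonMomentAngle n))) :=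
    AddAction.isOpenQuotientMap_quotientMk
  have : Nonempty (polygonMomentAngle n) := ⟨v⟩
  have hinv : ∀ (e : OpenPartialHomeomorph (PolygonQuotient n) ℂ) (g : ZMod n) y,
      e (Quotient.mk _ (g +ᵥ y)) = e (Quotient.mk _ y) := fun e g y => by
    rw [← polygonQuotient_mk_eq_iff.2 ⟨g, rfl⟩]
  by_cases hv : ∃ k, |v.1 k| < 1
  · obtain ⟨k, ε, hε, hvk⟩ := exists_mem_edgeStar hv
    obtain ⟨U, hU, hvU, hUg⟩ := exists_isOpen_forall_vadd_ne hn hv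
    obtain ⟨e, hes, he⟩ := hq.exists_openPartialHomeomorph (hU.inter (isOpen_edgeStar k ε))
      (continuous_edgeCoord k ε).continuousOn
      (fun x hx => (map_edgeCoord_nhds hn hε hx.2).ge) (fun x hx y hy => by
        rw [polygonQuotient_mk_eq_iff]
        constructor
        · intro h
          exact ⟨0, by rw [zero_vadd, injOn_edgeCoord hn hε k hx.2 hy.2 h]⟩
        · rintro ⟨g, hg⟩
          have hg0 := hUg x hx.1 y hy.1 g hg
          rw [hg0, zero_vadd] at hg
          rw [hg])
    refine ⟨e, hes ▸ mem_image_of_mem _ ⟨hvU, hvk⟩, fun x hx => Or.inl ?_⟩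
    rw [hes] at hx
    obtain ⟨y, hy, hyx⟩ := hx
    obtain ⟨g, hg⟩ := polygonQuotient_mk_eq_iff.1 hyx.symm
    have hflat : IsFlatBiholomorphicAt (fun y => e (Quotient.mk _ y)) y := by
      refine IsFlatBiholomorphicAt.of_edgeCoord hn hε hy.2 (hasStrictDerivAt_id _) one_ne_zero ?_
      filter_upwards [(hU.inter (isOpen_edgeStar k ε)).mem_nhds hy] with z hz
      exact he z hz
    refine ⟨⟨k + g, ?_⟩, IsFlatBiholomorphicAt.of_vadd (hinv e) (g := g) (hg ▸ hflat)⟩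
    have := hy.2.1
    rwa [← hg] at this
  · push Not at hv
    have hε : ∀ j, |v.1 j| = 1 := fun j => le_antisymm (abs_coord_le_one v j) (hv j)
    obtain ⟨e, hes, he⟩ := hq.exists_openPartialHomeomorph (isOpen_vertexStar v.1)
      ((continuous_orientConj hε).comp_continuousOn (continuousOn_coneChart hn hε))
      (fun x hx => nhds_le_map_coneChart hn hε hx) (fun x hx y hy => by
        rw [polygonQuotient_mk_eq_iff, ← coneChart_eq_iff hn hε hx hy]
        exact (orientConj_involutive hε).injective.eq_iff)
    have hvv : v ∈ vertexStar v.1 := fun j => by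
      rw [mul_self_of_abs_eq_one (hε j)]
      exact one_pos
    refine ⟨e, hes ▸ mem_image_of_mem _ hvv, fun x hx => ?_⟩
    rw [hes] at hx
    obtain ⟨y, hy, hyx⟩ := hx
    by_cases hyv : y = v
    · subst hyv
      obtain ⟨g, hg⟩ := polygonQuotient_mk_eq_iff.1 hyx
      refine Or.inr ⟨?_, hyx.symm⟩
      rintro ⟨k, hk⟩
      rw [← hg, polygonMomentAngle.vadd_apply, hε] at hk
      exact lt_irrefl _ hk
    · refine Or.inl ?_
      have hyv' : y.1 ≠ v.1 := fun h => hyv (Subtype.ext h)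
      obtain ⟨g, hg⟩ := polygonQuotient_mk_eq_iff.1 hyx.symm
      obtain ⟨k, hk⟩ := exists_sign_mul_coord_lt_one hε hyv'
      have hflat : IsFlatBiholomorphicAt (fun y => e (Quotient.mk _ y)) y := by
        refine (isFlatBiholomorphicAt_coneChart hn hε hy hyv').congr ?_
        filter_upwards [(isOpen_vertexStar v.1).mem_nhds hy] with z hz
        exact he z hz
      refine ⟨⟨k + g, ?_⟩, IsFlatBiholomorphicAt.of_vadd (hinv e) (g := g) (hg ▸ hflat)⟩
      have := abs_coord_lt_one hε hy hk
      rwa [← hg] at this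

/-- Where two charts are both conformal, their transition map is conformal. A point where one of
them is not is the centre of that chart, and it lies in no other chart of the atlas, so that the
transition map is the identity. -/
theorem isOrientableSurface_polygonQuotient [NeZero n] (hn : 3 ≤ n) :
    IsOrientableSurface (PolygonQuotient n) := by
  choose e he hflat using exists_flat_chart (n := n) hn
  refine ⟨range e, fun p => ⟨e p, ⟨p, rfl⟩, he p⟩, ?_⟩
  rintro _ ⟨p, rfl⟩ _ ⟨p', rfl⟩ z hz
  set T := (e p).symm.trans (e p') with hT
  have hcont : ∀ᶠ w in 𝓝 z, ContinuousAt T w := by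
    filter_upwards [T.open_source.mem_nhds hz] with w hw
    exact T.continuousAt hw
  suffices ∃ c, c ≠ 0 ∧ HasDerivAt T c z by
    obtain ⟨c, hc, hd⟩ := this
    exact PreservesOrientationAt.of_hasDerivAt hd hc hcont
  have hz' := hz
  rw [hT, OpenPartialHomeomorph.trans_source] at hz'
  have hzt : z ∈ (e p).target := hz'.1
  have hsrc' : (e p).symm z ∈ (e p').source := hz'.2
  have hsrc : (e p).symm z ∈ (e p).source := (e p).map_target hzt
  obtain ⟨x, hx⟩ := Quotient.exists_rep ((e p).symm z)
  have hzx : e p (Quotient.mk _ x) = z := by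
    rw [hx, (e p).right_inv hzt]
  rw [← hx] at hsrc hsrc'
  have hself : p = p' → ∃ c, c ≠ 0 ∧ HasDerivAt T c z := by
    intro hpp
    refine ⟨1, one_ne_zero, (hasDerivAt_id z).congr_of_eventuallyEq ?_⟩
    filter_upwards [T.open_source.mem_nhds hz] with w hw
    rw [hT, OpenPartialHomeomorph.trans_source] at hw
    rw [hT, OpenPartialHomeomorph.coe_trans, Function.comp_apply, ← hpp, (e p).right_inv hw.1, id]
  have hmk : Continuous (Quotient.mk (AddAction.orbitRel (ZMod n) (polygonMomentAngle n))) :=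
    continuous_quot_mk
  have hτ : ∀ᶠ y in 𝓝 x, T (e p (Quotient.mk _ y)) = e p' (Quotient.mk _ y) := by
    filter_upwards [hmk.continuousAt.preimage_mem_nhds ((e p).open_source.mem_nhds hsrc)] with y hy
    rw [hT, OpenPartialHomeomorph.coe_trans, Function.comp_apply, (e p).left_inv hy]
  rcases hflat p x hsrc with ⟨hk, h⟩ | ⟨hk, h⟩ <;>
    rcases hflat p' x hsrc' with ⟨hk', h'⟩ | ⟨hk', h'⟩
  · rw [← hzx]
    exact h.exists_hasDerivAt hn h' hk hτ
  · exact absurd hk hk'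
  · exact absurd hk' hk
  · exact hself (h.symm.trans h')

end Atlas

theorem mainTheorem4 (n : ℕ) (hn : 3 ≤ n) :
    IsClosedSurface (PolygonQuotient n) ∧ ConnectedSpace (PolygonQuotient n) ∧
      IsOrientableSurface (PolygonQuotient n) := by
  have : NeZero n := ⟨by omega⟩
  have hcompact : CompactSpace (polygonMomentAngle n) :=
    isCompact_iff_compactSpace.1 isCompact_polygonMomentAngle
  have hconn : ConnectedSpace (polygonMomentAngle n) :=
    isConnected_iff_connectedSpace.1 isPathConnected_polygonMomentAngle.isConnected
  refine ⟨⟨inferInstance, ContinuousConstVAdd.secondCountableTopology, inferInstance,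
    fun p => ?_⟩, inferInstance, isOrientableSurface_polygonQuotient hn⟩
  obtain ⟨e, he, -⟩ := exists_flat_chart hn p
  exact ⟨e.trans Complex.orthonormalBasisOneI.repr.toHomeomorph.toOpenPartialHomeomorph,
    by simpa using he⟩
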